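/- Let $N\ge 1$ be an integer, $a>0$ real, and let $\mu_1,\dots,\mu_N>0$ and $\delta_k^{(\lambda)}$ ($1\le k\le N$, $\lambda\in\mathbb N_0$) be real numbers such that $$\left(\frac{\mu_j}{\mu_k}\right)^2=a^{k-j}\frac{(N-k)!}{(N-j)!},\qquad \delta_k^{(\lambda)}=\left(\frac a2\right)^{\lambda}\frac{(\lambda+k-1)!}{(k-1)!}\qquad(1\le j,k\le N,\ \lambda\in\mathbb N_0).$$ Let $A$ be the $N\times N$ matrix with $A_{k+1,k}=\mu_{k+1}/\mu_k$ and all other entries $0$, let $T^{(\lambda)}=\mathrm{diag}(\delta_1^{(\lambda)},\dots,\delta_N^{(\lambda)})$, $J=\mathrm{diag}(1,\dots,N)$, and $$W^{(\lambda)}(x)=\frac{a^x}{x!}(I+A)^{x+\lambda}\,T^{(\lambda)}\,(I+A^*)^{x+\lambda},\qquad x\in\mathbb N_0 .$$ Let $L_0$ be the unipotent lower triangular matrix $L_0=L(0)$, where $L(x)_{j,k}=\frac{\mu_j}{\mu_k}(-a)^{j-k}\frac{c^{(a)}_{j-k}(x)}{(j-k)!}$ for $j\ge k$ and $L(x)_{j,k}=0$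 for $j<k$, and $c^{(a)}_n(x)=\sum_{k=0}^{n}\frac{(-n)_k(-x)_k}{k!}\left(-\frac1a\right)^k$ are the scalar Charlier polynomials. Here $(z)_k=z(z+1)\cdots(z+k-1)$. Then, for every $\lambda\in\mathbb N_0$, $W^{(\lambda)}$ is a matrix weight on $\mathbb N_0$: each $W^{(\lambda)}(x)$ is positive definite and all moments $\sum_{x\ge0}x^kW^{(\lambda)}(x)$ converge. There is a unique sequence $(P^{(\lambda)}_n)_{n\ge0}$ in $M_N(\mathbb C)[x]$, with $P_n^{(\lambda)}$ monic of degree $n$, that is orthogonal for $\langle P,Q\rangle^{(\lambda)}=\sum_{x=0}^\infty P(x)W^{(\lambda)}(x)Q(x)^*$. Its square norms $\mathcal H_n^{(\lambda)}=\langle P_n^{(\lambda)},P_n^{(\lambda)}\rangle^{(\lambda)}$ have the LDU decomposition $$\mathcal H_n^{(\lambda)}=L_0^{-1}(I+A)^{n+\lambda}\,\mathcal D_n^{(\lambda)}\,(I+A^*)^{n+\lambda}(L_0^*)^{-1},\qquad \lambda,n\in\mathbb N_0,$$ where $\mathcal D_n^{(\lambda)}=L_0(I+A)^{-n-\lambda}\mathcal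 H_n^{(\lambda)}(I+A^*)^{-n-\lambda}L_0^*$ is a positive definite diagonal matrix. Its diagonal entries are, for $1\le j\le N$ and all $\lambda,n\in\mathbb N_0$, $$(\mathcal D_n^{(\lambda)})_{jj}=(-1)^j e^a\,n!\,a^n\left(\frac a2\right)^{\lambda}\frac{(\lambda+N-j)!}{(j-1)!}\,\frac{(-N-\lambda-n)_j}{(\lambda+n+1)_{N-j+1}} .$$ Moreover, for all $\lambda,n\in\mathbb N_0$, $$\mathcal D_n^{(\lambda)}=n!\,2^n\,\mathcal D_0^{(\lambda+n)}\left(\Lambda_n^{(\lambda)}\right)^{-1},\qquad \Lambda_n^{(\lambda)}=\prod_{m=1}^n\bigl((N+\lambda+m)I-J\bigr).$$ -/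

import Mathlib

open scoped ComplexOrder Polynomial Matrix Nat

noncomputable section

namespace MVCharlier

/-- Complex `N × N` matrices. The row and column numbers `1, …, N` of the mathematics are
represented by `Fin N`, the element `i` standing for the number `i + 1`. -/
abbrev Mat (N : ℕ) : Type := Matrix (Fin N) (Fin N) ℂ

/-! ### Matrix valued orthogonal polynomials for a weight on the nonnegative integers -/

/-- A weight: positive definite at every point of `ℕ`, with finite moments of all orders. -/
def IsWeight {N : ℕ} (W : ℕ → Mat N) : Prop :=
  (∀ x, (W x).PosDef) ∧ ∀ k : ℕ, Summable fun x : ℕ => ((x : ℂ) ^ k) • W x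

/-- The value `P(x)` of a matrix polynomial at the scalar `x ∈ ℕ`. -/
def evalAt {N : ℕ} (P : (Mat N)[X]) (x : ℕ) : Mat N := P.eval (x : Mat N)

/-- The matrix valued inner product `⟨P, Q⟩ = ∑ₓ P(x) W(x) Q(x)^*`. -/
def innerProd {N : ℕ} (W : ℕ → Mat N) (P Q : (Mat N)[X]) : Mat N :=
  ∑' x : ℕ, evalAt P x * W x * (evalAt Q x)ᴴ

/-- `P` is the sequence of monic orthogonal polynomials for `W`: each `P n` is monic of degree
`n`, and different members are orthogonal. -/
def IsMonicMVOP {N : ℕ} (W : ℕ → Mat N) (P : ℕ → (Mat N)[X]) : Prop :=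
  (∀ n, (P n).Monic ∧ (P n).natDegree = n) ∧
    ∀ m n, m ≠ n → innerProd W (P m) (P n) = 0

/-- The square norm `ℋ_n = ⟨P_n, P_n⟩`. -/
def sqNorm {N : ℕ} (W : ℕ → Mat N) (P : ℕ → (Mat N)[X]) (n : ℕ) : Mat N :=
  innerProd W (P n) (P n)

/-! ### The Charlier weights -/

/-- The Pochhammer symbol `(z)_k = z (z + 1) ⋯ (z + k - 1)`. -/
def poch (z : ℂ) (k : ℕ) : ℂ := (ascPochhammer ℂ k).eval z

/-- The scalar Charlier polynomial `c_n^{(a)}(x) = ₂F₀(-n, -x; —; -1/a)`. -/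
def charlier (a : ℝ) (n : ℕ) (x : ℂ) : ℂ :=
  ∑ k ∈ Finset.range (n + 1),
    poch (-(n : ℂ)) k * poch (-x) k / (k ! : ℂ) * (-1 / (a : ℂ)) ^ k

/-- The matrix `A` with entries `μ_j / μ_{j-1}` on the first subdiagonal. -/
def matA {N : ℕ} (μ : Fin N → ℝ) : Mat N :=
  Matrix.of fun j k => if (j : ℕ) = (k : ℕ) + 1 then ((μ j / μ k : ℝ) : ℂ) else 0

/-- The matrix `T = diag(δ_1, …, δ_N)`. -/
def matT {N : ℕ} (δ : Fin N → ℝ) : Mat N :=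
  Matrix.diagonal fun j => (δ j : ℂ)

/-- The matrix `J = diag(1, …, N)`. -/
def matJ (N : ℕ) : Mat N :=
  Matrix.diagonal fun j => (((j : ℕ) + 1 : ℕ) : ℂ)

/-- The weight `W^{(lam)}(x) = (a^x / x!) (I + A)^{x+lam} T^{(lam)} (I + A^*)^{x+lam}`. -/
def weight {N : ℕ} (a : ℝ) (μ : Fin N → ℝ) (δ : ℕ → Fin N → ℝ) (lam : ℕ) (x : ℕ) : Mat N :=
  ((a : ℂ) ^ x / (x ! : ℂ)) •
    ((1 + matA μ) ^ (x + lam) * matT (δ lam) * (1 + (matA μ)ᴴ) ^ (x + lam))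

/-- The unipotent lower triangular matrix polynomial `L(x)` with entries
`(μ_j / μ_k) (-a)^{j-k} c_{j-k}^{(a)}(x) / (j-k)!` for `j ≥ k`. -/
def matL {N : ℕ} (a : ℝ) (μ : Fin N → ℝ) (x : ℂ) : Mat N :=
  Matrix.of fun j k =>
    if k ≤ j then
      ((μ j / μ k : ℝ) : ℂ) * (-(a : ℂ)) ^ ((j : ℕ) - (k : ℕ)) *
        charlier a ((j : ℕ) - (k : ℕ)) x / (((j : ℕ) - (k : ℕ)) ! : ℂ)
    else 0

/-- The middle factor `𝒟` in the decomposition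
`ℋ = L(0)⁻¹ (I + A)^k 𝒟 (I + A^*)^k (L(0)^*)⁻¹` of a matrix `ℋ`; the outer factors are
invertible, so this equation determines `𝒟`. -/
def midFactor {N : ℕ} (a : ℝ) (μ : Fin N → ℝ) (k : ℕ) (H : Mat N) : Mat N :=
  matL a μ 0 * ((1 + matA μ) ^ k)⁻¹ * H * ((1 + (matA μ)ᴴ) ^ k)⁻¹ * (matL a μ 0)ᴴ

/-- The factor `𝒟_n^{(lam)}` of the square norm `ℋ_n^{(lam)}` of the polynomials `P^{(lam)}_n`. -/
def matD {N : ℕ} (a : ℝ) (μ : Fin N → ℝ) (δ : ℕ → Fin N → ℝ) (P : ℕ → ℕ → (Mat N)[X])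
    (lam n : ℕ) : Mat N :=
  midFactor a μ (n + lam) (sqNorm (weight a μ δ lam) (P lam) n)

/-- The diagonal matrix `Λ_n^{(lam)} = ∏_{m=1}^n ((N + lam + m) I - J)`. -/
def matLam (N lam n : ℕ) : Mat N :=
  ((List.range n).map fun i => (((N + lam + (i + 1) : ℕ) : ℂ) • (1 : Mat N) - matJ N)).prod

/-- The parameter choice: with `j`, `k` running over `1, …, N`,
`(μ_j / μ_k)^2 = a^{k-j} (N-k)! / (N-j)!` and
`δ_k^{(lam)} = (a/2)^lam (lam + k - 1)! / (k - 1)!`. -/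
def ParameterChoice {N : ℕ} (a : ℝ) (μ : Fin N → ℝ) (δ : ℕ → Fin N → ℝ) : Prop :=
  (∀ j k : Fin N, (μ j / μ k) ^ 2 =
      a ^ (((k : ℕ) : ℤ) - ((j : ℕ) : ℤ)) *
        (((N - ((k : ℕ) + 1)) ! : ℝ) / ((N - ((j : ℕ) + 1)) ! : ℝ))) ∧
    ∀ (lam : ℕ) (k : Fin N), δ lam k =
      (a / 2) ^ lam * (((lam + (k : ℕ)) ! : ℝ) / ((k : ℕ) ! : ℝ))

/-- The closed form, for `j ∈ {1, …, N}`,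
`(-1)^j e^a n! a^n (a/2)^lam ((lam+N-j)! / (j-1)!) (-N-lam-n)_j / (lam+n+1)_{N-j+1}`. -/
def entryD (N : ℕ) (a : ℝ) (lam n j : ℕ) : ℂ :=
  (-1) ^ j * (Real.exp a : ℂ) * (n ! : ℂ) * (a : ℂ) ^ n * ((a : ℂ) / 2) ^ lam *
    (((lam + N - j) ! : ℂ) / ((j - 1) ! : ℂ)) *
    (poch (-(N : ℂ) - lam - n) j / poch ((lam : ℂ) + n + 1) (N - j + 1))

end MVCharlier

end

/-! A Rodrigues formula carries the proof. Write M = A(I+A)⁻¹. The parameter choice yields a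
superdiagonal B with [A,B] = J − (N+1)/2 and T^{(λ+1)}A* = B T^{(λ)}. Hence W^{(λ+1)}(x) and
W^{(λ+1)}(x−1) are both W^{(λ)}(x) multiplied on the left by quadratic matrix polynomials in x
(`weight_succ`, `weight_succ_shift`). Their x² coefficients agree, so Q ↦ ∇(Q W^{(λ+1)}) (W^{(λ)})⁻¹
raises the degree by one only (`exists_raising`).

Iterating from Q = 1 gives R_n with R_n W^{(λ)} = ∇ⁿ W^{(λ+n)}. Summation by parts gives ⟨R_n, P⟩ =
(−1)ⁿ n! (∑ W^{(λ+n)}) p_n* whenever P has degree at most n and coefficient p_n of xⁿ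
(`exists_rodrigues`). This duality gives existence, uniqueness and ℋ_n at once, once the leading
coefficient of R_n and the zeroth moment are known.

Put F = exp(aA)(I+A)^{n+λ}. Conjugation by F carries J to J − aA − (n+λ)M, so the leading
coefficient is (−1/2)ⁿ F Λ F⁻¹. The zeroth moment is e^a F Y F* with Y diagonal, by an operator
exponential and a Vandermonde sum. Thus ℋ_n = n! 2ⁿ e^a F Λ⁻¹ Y F*. Since L(0) = exp(−aA), the outer
factors of the decomposition are F and F*, and 𝒟_n = n! 2ⁿ e^a Y Λ⁻¹. -/

noncomputable section

namespace MVCharlier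

open Polynomial

/-! ### Relations between the matrices `A`, `J` and `T` -/

/-- The matrix with entries `(a / 2) k μ_{k+1} / μ_k` on the first superdiagonal. -/
def matB {N : ℕ} (a : ℝ) (μ : Fin N → ℝ) : Mat N :=
  Matrix.of fun j k => if (k : ℕ) = (j : ℕ) + 1 then
    (a : ℂ) / 2 * ((j : ℕ) + 1) * ((μ k / μ j : ℝ) : ℂ) else 0

/-- Conjugation by diag(μ) turns A into the plain shift, so the ratios telescope along a power. -/
theorem matA_pow_apply {N : ℕ} {μ : Fin N → ℝ} (hμ : ∀ j, 0 < μ j) (i : ℕ) (j k : Fin N) :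
    (matA μ ^ i) j k = if (j : ℕ) = (k : ℕ) + i then ((μ j / μ k : ℝ) : ℂ) else 0 := by
  induction i generalizing k with
  | zero =>
    have := (hμ j).ne'
    by_cases h : j = k
    · subst h; simp [this]
    · simp [h, Fin.val_inj]
  | succ i ih =>
    rw [pow_succ, Matrix.mul_apply]
    simp only [ih]
    by_cases h : (k : ℕ) + 1 < N
    · rw [Finset.sum_eq_single ⟨(k : ℕ) + 1, h⟩]
      · have h1 := (hμ ⟨(k : ℕ) + 1, h⟩).ne'
        have h2 := (hμ k).ne'
        simp only [matA, Matrix.of_apply, if_true]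
        by_cases h3 : (j : ℕ) = k + 1 + i
        · rw [if_pos h3, if_pos (by omega), ← Complex.ofReal_mul]
          congr 1; field_simp
        · rw [if_neg h3, if_neg (by omega), zero_mul]
      · intro l _ hl
        have : (l : ℕ) ≠ k + 1 := fun h' => hl (Fin.ext h')
        simp [matA, this]
      · simp
    · rw [if_neg (by omega)]
      refine Finset.sum_eq_zero fun l _ => ?_
      have : (l : ℕ) ≠ k + 1 := by omega
      simp [matA, this]

theorem matA_pow_eq_zero {N : ℕ} {μ : Fin N → ℝ} (hμ : ∀ j, 0 < μ j) {i : ℕ} (hi : N ≤ i) :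
    matA μ ^ i = 0 := by
  ext j k
  rw [matA_pow_apply hμ, if_neg (by omega), Matrix.zero_apply]

theorem matJ_mul_matA {N : ℕ} (μ : Fin N → ℝ) :
    matJ N * matA μ = matA μ * matJ N + matA μ := by
  ext j k
  simp only [matJ, Matrix.diagonal_mul, Matrix.mul_diagonal, Matrix.add_apply, matA,
    Matrix.of_apply]
  split_ifs with h
  · rw [h]; push_cast; ring
  · simp

theorem sq_ratio {N : ℕ} {a : ℝ} {μ : Fin N → ℝ} {δ : ℕ → Fin N → ℝ} (ha : 0 < a)
    (hpar : ParameterChoice a μ δ) {j k : Fin N} {m : ℕ} (h : (j : ℕ) = k + m) :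
    (μ j / μ k) ^ 2 * a ^ m = ((N - (k + 1)) ! : ℝ) / ((N - (j + 1)) ! : ℝ) := by
  rw [hpar.1 j k, h]
  have : (((k : ℕ) : ℤ) - ((k + m : ℕ) : ℤ)) = -(m : ℤ) := by push_cast; ring
  rw [this, zpow_neg, zpow_natCast]
  have := (pow_pos ha m).ne'
  field_simp

theorem sq_ratio_succ {N : ℕ} {a : ℝ} {μ : Fin N → ℝ} {δ : ℕ → Fin N → ℝ} (ha : 0 < a)
    (hpar : ParameterChoice a μ δ) {j k : Fin N} (h : (j : ℕ) = k + 1) :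
    (a : ℂ) * ((μ j / μ k : ℝ) : ℂ) ^ 2 = (N : ℂ) - j := by
  have h1 := sq_ratio ha hpar h
  obtain ⟨p, hp⟩ : ∃ p, N = j + 1 + p := ⟨N - (j + 1), by have := j.2; omega⟩
  have e1 : N - ((k : ℕ) + 1) = p + 1 := by omega
  have e2 : N - ((j : ℕ) + 1) = p := by omega
  rw [e1, e2, Nat.factorial_succ, pow_one] at h1
  have hf : ((p ! : ℕ) : ℝ) ≠ 0 := by positivity
  have h2 : a * (μ j / μ k) ^ 2 = p + 1 := by
    rw [mul_comm, h1]; push_cast; field_simp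
  have h3 : (a : ℂ) * ((μ j / μ k : ℝ) : ℂ) ^ 2 = p + 1 := by
    rw [← Complex.ofReal_pow, ← Complex.ofReal_mul, h2]; push_cast; rfl
  have h4 : (N : ℂ) = j + 1 + p := by exact_mod_cast hp
  rw [h3, h4]; ring

/-- AB and BA are diagonal with entries quadratic in the index, and their difference is linear. This
is the sl₂ relation behind the Pearson equations; of the choice of μ it uses only consecutive
ratios. -/
theorem matA_mul_matB {N : ℕ} {a : ℝ} {μ : Fin N → ℝ} {δ : ℕ → Fin N → ℝ} (ha : 0 < a)
    (hpar : ParameterChoice a μ δ) :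
    matA μ * matB a μ = matB a μ * matA μ + (matJ N - (((N : ℂ) + 1) / 2) • 1) := by
  have hAB : matA μ * matB a μ =
      Matrix.diagonal fun j : Fin N => ((j : ℕ) : ℂ) * ((N : ℂ) - j) / 2 := by
    ext j k
    rw [Matrix.mul_apply]
    rcases Nat.eq_zero_or_pos j with h | h
    · rw [Finset.sum_eq_zero]
      · by_cases hjk : j = k
        · subst hjk; simp [h]
        · simp [hjk]
      · intro l _
        have : (j : ℕ) ≠ l + 1 := by omega
        simp [matA, this]
    · have hl : (j : ℕ) - 1 < N := by have := j.2; omega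
      rw [Finset.sum_eq_single ⟨(j : ℕ) - 1, hl⟩]
      · have h1 : (j : ℕ) = (j : ℕ) - 1 + 1 := by omega
        by_cases hjk : j = k
        · subst hjk
          have h3 := sq_ratio_succ ha hpar (j := j) (k := ⟨(j : ℕ) - 1, hl⟩) h1
          have h4 : (((j : ℕ) - 1 : ℕ) : ℂ) + 1 = j := by exact_mod_cast h1.symm
          simp only [matA, matB, Matrix.of_apply, Matrix.diagonal_apply_eq, if_pos h1, h4, ← h3]
          ring
        · have h2 : (k : ℕ) ≠ (j : ℕ) - 1 + 1 := fun h' => hjk (Fin.ext (by omega))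
          simp [matA, matB, hjk, h2]
      · intro l _ hl'
        have : (j : ℕ) ≠ l + 1 := fun h' => hl' (Fin.ext (by simp [h']))
        simp [matA, this]
      · simp
  have hBA : matB a μ * matA μ =
      Matrix.diagonal fun j : Fin N => (((j : ℕ) : ℂ) + 1) * ((N : ℂ) - (j + 1)) / 2 := by
    ext j k
    rw [Matrix.mul_apply]
    by_cases h : (j : ℕ) + 1 < N
    · rw [Finset.sum_eq_single ⟨(j : ℕ) + 1, h⟩]
      · by_cases hjk : j = k
        · subst hjk
          have h3 := sq_ratio_succ ha hpar (j := ⟨(j : ℕ) + 1, h⟩) (k := j) rfl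
          simp only [matA, matB, Matrix.of_apply, Matrix.diagonal_apply_eq, if_true]
          push_cast at h3 ⊢
          rw [← h3]
          ring
        · have h2 : (j : ℕ) ≠ k := fun h' => hjk (Fin.ext h')
          simp [matA, matB, hjk, h2]
      · intro l _ hl'
        have : (l : ℕ) ≠ j + 1 := fun h' => hl' (Fin.ext (by simp [h']))
        simp [matB, this]
      · simp
    · rw [Finset.sum_eq_zero]
      · have h1 : (j : ℕ) + 1 = N := by have := j.2; omega
        have h2 : (N : ℂ) = j + 1 := by exact_mod_cast h1.symm
        by_cases hjk : j = k
        · subst hjk; simp [h2]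
        · simp [hjk]
      · intro l _
        have : (l : ℕ) ≠ j + 1 := by omega
        simp [matB, this]
  rw [hAB, hBA, matJ, Matrix.smul_one_eq_diagonal, Matrix.diagonal_sub, Matrix.diagonal_add]
  congr 1
  funext j
  push_cast
  ring

theorem delta_succ {N : ℕ} {a : ℝ} {μ : Fin N → ℝ} {δ : ℕ → Fin N → ℝ}
    (hpar : ParameterChoice a μ δ) (lam : ℕ) (k : Fin N) :
    δ (lam + 1) k = a / 2 * (lam + (k + 1)) * δ lam k := by
  rw [hpar.2, hpar.2, show lam + 1 + (k : ℕ) = lam + k + 1 by ring, Nat.factorial_succ]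
  push_cast; ring

theorem matT_succ {N : ℕ} {a : ℝ} {μ : Fin N → ℝ} {δ : ℕ → Fin N → ℝ}
    (hpar : ParameterChoice a μ δ) (lam : ℕ) :
    matT (δ (lam + 1)) = ((a : ℂ) / 2) • (((lam : ℂ) • 1 + matJ N) * matT (δ lam)) := by
  rw [matJ, Matrix.smul_one_eq_diagonal, matT, matT, Matrix.diagonal_add,
    Matrix.diagonal_mul_diagonal, ← Matrix.diagonal_smul]
  congr 1
  funext k
  simp only [delta_succ hpar, Pi.smul_apply, smul_eq_mul]
  push_cast; ring

/-- Moves A* across T. Together with `matT_succ` it absorbs the extra right factor I + A* of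
W^{(λ+1)}. -/
theorem matT_succ_mul {N : ℕ} {a : ℝ} {μ : Fin N → ℝ} {δ : ℕ → Fin N → ℝ}
    (hpar : ParameterChoice a μ δ) (lam : ℕ) :
    matT (δ (lam + 1)) * (matA μ)ᴴ = matB a μ * matT (δ lam) := by
  ext j k
  simp only [matT, matA, matB, Matrix.diagonal_mul, Matrix.mul_diagonal,
    Matrix.conjTranspose_apply, Matrix.of_apply]
  split_ifs with h
  · have : δ (lam + 1) j = a / 2 * (j + 1) * δ lam k := by
      rw [hpar.2, hpar.2, h, show lam + ((j : ℕ) + 1) = lam + 1 + j by ring,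
        Nat.factorial_succ (j : ℕ)]
      have : ((j : ℕ) ! : ℝ) ≠ 0 := by positivity
      push_cast; field_simp; ring
    rw [this, Complex.star_def, Complex.conj_ofReal]
    push_cast; ring
  · simp

/-! ### Conjugation by powers of `1 + A` -/

section Conjugation

variable {R : Type*} [Ring R] [Algebra ℂ R] {T A J B H U M : R}

/-- Applied to T = I + A: each T moved past J subtracts M, and M commutes with T, so the shifts add
up. -/
theorem pow_mul_of_raising (hT : T * J = J * T - A) (h1 : T * M = A) (h2 : M * T = A) (y : ℕ) :
    T ^ y * J = (J - (y : ℂ) • M) * T ^ y := by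
  induction y with
  | zero => simp
  | succ y ih =>
    have : T * (J - (y : ℂ) • M) = (J - ((y + 1 : ℕ) : ℂ) • M) * T := by
      simp only [mul_sub, sub_mul, mul_smul_comm, smul_mul_assoc, hT, h1, h2]
      push_cast; module
    rw [pow_succ', mul_assoc, ih, ← mul_assoc, this, mul_assoc]

/-- Here U stands for T⁻¹. Moving one T to the right turns B into B + UH − MU and UH into UH − MU,
so the coefficient of MU accumulates 1 + ⋯ + y. -/
theorem pow_mul_of_lowering (hB : T * B = B * T + H) (hUH : T * (U * H) = H)
    (hUH' : U * H * T = H + M) (hMU : T * (M * U) = M) (hMU' : M * U * T = M) (y : ℕ) :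
    T ^ y * B = (B + (y : ℂ) • (U * H) - (((y : ℂ) ^ 2 + y) / 2) • (M * U)) * T ^ y := by
  induction y with
  | zero => simp
  | succ y ih =>
    have : T * (B + (y : ℂ) • (U * H) - (((y : ℂ) ^ 2 + y) / 2) • (M * U)) =
        (B + ((y + 1 : ℕ) : ℂ) • (U * H) -
          ((((y + 1 : ℕ) : ℂ) ^ 2 + (y + 1 : ℕ)) / 2) • (M * U)) * T := by
      simp only [mul_sub, sub_mul, mul_add, add_mul, mul_smul_comm, smul_mul_assoc, hB, hUH,
        hUH', hMU, hMU']
      push_cast; module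
    rw [pow_succ', mul_assoc, ih, ← mul_assoc, this, mul_assoc]

end Conjugation

/-- `I + A` is invertible. -/
theorem isUnit_one_add_matA {N : ℕ} {μ : Fin N → ℝ} (hμ : ∀ j, 0 < μ j) :
    IsUnit (1 + matA μ) := by
  have : IsNilpotent (matA μ) := ⟨N, matA_pow_eq_zero hμ le_rfl⟩
  exact this.isUnit_one_add

/-- The matrix `A (I + A)⁻¹`. -/
def matM {N : ℕ} (μ : Fin N → ℝ) : Mat N := matA μ * (1 + matA μ)⁻¹

/-- The matrix `J - (N + 1) / 2`. -/
def matH (N : ℕ) : Mat N := matJ N - (((N : ℂ) + 1) / 2) • 1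

/-! ### Commutation relations for I + A and the Pearson equations -/

section Relations

variable {N : ℕ} {μ : Fin N → ℝ}

theorem mul_inv_one_add (hμ : ∀ j, 0 < μ j) : (1 + matA μ) * (1 + matA μ)⁻¹ = 1 :=
  Matrix.mul_nonsing_inv _ ((Matrix.isUnit_iff_isUnit_det _).1 (isUnit_one_add_matA hμ))

theorem inv_mul_one_add (hμ : ∀ j, 0 < μ j) : (1 + matA μ)⁻¹ * (1 + matA μ) = 1 :=
  Matrix.nonsing_inv_mul _ ((Matrix.isUnit_iff_isUnit_det _).1 (isUnit_one_add_matA hμ))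

theorem matM_eq (hμ : ∀ j, 0 < μ j) : matM μ = 1 - (1 + matA μ)⁻¹ := by
  have := mul_inv_one_add hμ
  rw [add_mul, one_mul] at this
  rw [matM, eq_sub_iff_add_eq, add_comm, this]

theorem matM_mul (hμ : ∀ j, 0 < μ j) : matM μ * (1 + matA μ) = matA μ := by
  rw [matM, mul_assoc, inv_mul_one_add hμ, mul_one]

theorem mul_matM (hμ : ∀ j, 0 < μ j) : (1 + matA μ) * matM μ = matA μ := by
  rw [matM_eq hμ, mul_sub, mul_inv_one_add hμ, mul_one, add_sub_cancel_left]

theorem one_add_mul_matJ : (1 + matA μ) * matJ N = matJ N * (1 + matA μ) - matA μ := by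
  rw [mul_add, matJ_mul_matA]; noncomm_ring

theorem pow_mul_matJ (hμ : ∀ j, 0 < μ j) (y : ℕ) :
    (1 + matA μ) ^ y * matJ N = (matJ N - (y : ℂ) • matM μ) * (1 + matA μ) ^ y :=
  pow_mul_of_raising one_add_mul_matJ (mul_matM hμ) (matM_mul hμ) y

theorem pow_mul_add_matJ (hμ : ∀ j, 0 < μ j) (lam y : ℕ) :
    (1 + matA μ) ^ y * ((lam : ℂ) • 1 + matJ N) =
      ((lam : ℂ) • 1 + matJ N - (y : ℂ) • matM μ) * (1 + matA μ) ^ y := by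
  rw [mul_add, pow_mul_matJ hμ]
  simp only [sub_mul, add_mul, mul_smul_comm, smul_mul_assoc, one_mul, mul_one]
  abel

theorem pow_mul_matB {a : ℝ} {δ : ℕ → Fin N → ℝ} (ha : 0 < a)
    (hμ : ∀ j, 0 < μ j) (hpar : ParameterChoice a μ δ) (y : ℕ) :
    (1 + matA μ) ^ y * matB a μ =
      (matB a μ + (y : ℂ) • ((1 + matA μ)⁻¹ * matH N) -
        (((y : ℂ) ^ 2 + y) / 2) • (matM μ * (1 + matA μ)⁻¹)) * (1 + matA μ) ^ y := by
  have hM : (1 + matA μ)⁻¹ * matA μ = matM μ := by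
    have := inv_mul_one_add hμ
    rw [mul_add, mul_one] at this
    rw [matM_eq hμ, eq_sub_iff_add_eq, add_comm, this]
  refine pow_mul_of_lowering ?_ ?_ ?_ ?_ ?_ y
  · rw [add_mul, matA_mul_matB ha hpar, matH]; noncomm_ring
  · rw [← mul_assoc, mul_inv_one_add hμ, one_mul]
  · have : matH N * (1 + matA μ) = (1 + matA μ) * matH N + matA μ := by
      rw [matH, mul_sub, sub_mul, one_add_mul_matJ, smul_mul_assoc, mul_smul_comm, one_mul,
        mul_one]
      abel
    rw [mul_assoc, this, mul_add, ← mul_assoc, inv_mul_one_add hμ, one_mul, hM]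
  · rw [← mul_assoc, mul_matM hμ, matM]
  · rw [mul_assoc, inv_mul_one_add hμ, mul_one]

/-- The matrix polynomial `Φ` with `W^{(lam+1)}(x) = Φ(x) W^{(lam)}(x)`, as a function of
`y = x + lam`. -/
def pearsonPhi (a : ℝ) (μ : Fin N → ℝ) (lam : ℕ) (y : ℂ) : Mat N :=
  (1 + matA μ) * matB a μ + y • matH N - ((y ^ 2 + y) / 2) • matM μ +
    ((a : ℂ) / 2) • ((1 + matA μ) * ((lam : ℂ) • 1 + matJ N) - y • matA μ)

/-- One factor I + A* next to T^{(λ+1)} becomes (a/2)(λ + J) + B to the left of T^{(λ)}; carrying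
(I+A)^{x+λ+1} past this bracket produces Φ. -/
theorem weight_succ {a : ℝ} {δ : ℕ → Fin N → ℝ} (ha : 0 < a)
    (hμ : ∀ j, 0 < μ j) (hpar : ParameterChoice a μ δ) (lam x : ℕ) :
    weight a μ δ (lam + 1) x =
      pearsonPhi a μ lam ((x : ℂ) + lam) * weight a μ δ lam x := by
  have key : (1 + matA μ) ^ (x + lam + 1) *
      (((a : ℂ) / 2) • ((lam : ℂ) • 1 + matJ N) + matB a μ) =
      pearsonPhi a μ lam ((x : ℂ) + lam) * (1 + matA μ) ^ (x + lam) := by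
    have hb := pow_mul_matB ha hμ hpar (x + lam)
    have hj := pow_mul_add_matJ hμ lam (x + lam)
    have e : ((x + lam : ℕ) : ℂ) = (x : ℂ) + lam := by push_cast; rfl
    have e1 : ((1 + matA μ) * ((((1 + matA μ)⁻¹ * matH N)))) = matH N := by
      rw [← mul_assoc, mul_inv_one_add hμ, one_mul]
    have e2 : (1 + matA μ) * (matM μ * (1 + matA μ)⁻¹) = matM μ := by
      rw [← mul_assoc, mul_matM hμ, matM]
    have e3 := mul_matM hμ
    rw [pow_succ', mul_assoc, mul_add, hb, mul_smul_comm, hj, ← smul_mul_assoc,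
      ← add_mul, ← mul_assoc, pearsonPhi]
    congr 1
    rw [e]
    simp only [mul_add, mul_sub, mul_smul_comm, e1, e2, e3]
    module
  have e1 : matT (δ (lam + 1)) * (1 + (matA μ)ᴴ) =
      (((a : ℂ) / 2) • ((lam : ℂ) • 1 + matJ N) + matB a μ) * matT (δ lam) := by
    rw [mul_add, matT_succ_mul hpar, mul_one, matT_succ hpar, add_mul (((a : ℂ) / 2) • _),
      smul_mul_assoc]
  rw [weight, weight, mul_smul_comm, ← mul_assoc, ← mul_assoc, ← key,
    show x + (lam + 1) = x + lam + 1 by ring, pow_succ' (1 + (matA μ)ᴴ), ← mul_assoc,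
    mul_assoc _ (matT (δ (lam + 1))), e1, ← mul_assoc]

/-- The exponents x + (λ+1) and (x+1) + λ agree, so only T changes. The scalar (x+1)/2 is a/2 from T
times (x+1)/a from the Poisson factor. -/
theorem weight_succ_shift {a : ℝ} {δ : ℕ → Fin N → ℝ} (ha : 0 < a)
    (hμ : ∀ j, 0 < μ j) (hpar : ParameterChoice a μ δ) (lam x : ℕ) :
    weight a μ δ (lam + 1) x =
      ((((x + 1 : ℕ) : ℂ)) / 2) • (((lam : ℂ) • 1 + matJ N -
        (((x + 1 : ℕ) : ℂ) + lam) • matM μ) * weight a μ δ lam (x + 1)) := by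
  have hj := pow_mul_add_matJ hμ lam (x + 1 + lam)
  have e : ((x + 1 + lam : ℕ) : ℂ) = ((x + 1 : ℕ) : ℂ) + lam := by push_cast; rfl
  have key : (1 + matA μ) ^ (x + 1 + lam) * matT (δ (lam + 1)) =
      ((a : ℂ) / 2) • (((lam : ℂ) • 1 + matJ N -
        (((x + 1 : ℕ) : ℂ) + lam) • matM μ) * (1 + matA μ) ^ (x + 1 + lam) *
        matT (δ lam)) := by
    rw [matT_succ hpar, mul_smul_comm, ← mul_assoc, hj, e]
  rw [weight, weight, show x + (lam + 1) = x + 1 + lam by ring, key]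
  simp only [mul_smul_comm, smul_mul_assoc, smul_smul, ← mul_assoc]
  congr 1
  rw [Nat.factorial_succ, pow_succ]
  have h1 : ((x ! : ℕ) : ℂ) ≠ 0 := by exact_mod_cast (Nat.factorial_pos x).ne'
  have h2 : ((x : ℂ) + 1) ≠ 0 := by exact_mod_cast Nat.succ_ne_zero x
  push_cast
  field_simp

end Relations

/-! ### Matrix polynomials -/

section MatrixPolynomials

variable {N : ℕ}

theorem evalAt_add (P Q : (Mat N)[X]) (x : ℕ) : evalAt (P + Q) x = evalAt P x + evalAt Q x :=
  eval_add

theorem evalAt_sub (P Q : (Mat N)[X]) (x : ℕ) : evalAt (P - Q) x = evalAt P x - evalAt Q x :=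
  eval_sub _ _ _

theorem evalAt_C (c : Mat N) (x : ℕ) : evalAt (C c) x = c := eval_C

theorem evalAt_X (x : ℕ) : evalAt (X : (Mat N)[X]) x = (x : ℂ) • 1 := by
  rw [evalAt, eval_X, ← nsmul_one, Nat.cast_smul_eq_nsmul]

/-- Evaluation is multiplicative despite noncommuting coefficients because natural number scalars
are central. -/
theorem evalAt_mul (P Q : (Mat N)[X]) (x : ℕ) : evalAt (P * Q) x = evalAt P x * evalAt Q x :=
  eval₂_mul_noncomm _ _ fun _ => (Nat.commute_cast _ _)

theorem evalAt_monomial (i : ℕ) (c : Mat N) (x : ℕ) :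
    evalAt (monomial i c) x = ((x : ℂ) ^ i) • c := by
  rw [evalAt, eval_monomial, ← nsmul_one, ← Nat.cast_smul_eq_nsmul ℂ, _root_.smul_pow, one_pow,
    mul_smul_comm, mul_one]

end MatrixPolynomials

/-- Induction through Q = Q₁X + q₀. Bounding D * X instead of D avoids m − 1, includes m = 0, and is
the form in which the raising operator meets the difference. -/
theorem exists_shift {R : Type*} [Ring R] (r : ℤ) (m : ℕ) (Q : R[X]) (hQ : Q.natDegree ≤ m) :
    ∃ D : R[X], (D * X).natDegree ≤ m ∧ (D * X).coeff m = (m * r : ℤ) • Q.coeff m ∧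
      ∀ z : ℤ, Q.eval ((z + r : ℤ) : R) = Q.eval (z : R) + D.eval (z : R) := by
  induction m generalizing Q with
  | zero =>
    refine ⟨0, by simp, by simp, fun z => ?_⟩
    rw [eq_C_of_natDegree_le_zero hQ]; simp
  | succ m ih =>
    obtain ⟨D, h1, h2, h3⟩ := ih Q.divX (by rw [natDegree_divX_eq_natDegree_tsub_one]; omega)
    have hQ0 : Q.divX.natDegree ≤ m := by rw [natDegree_divX_eq_natDegree_tsub_one]; omega
    have hD : D.natDegree ≤ m := by
      by_cases h : D = 0
      · simp [h]
      · have : Nontrivial R := ⟨⟨D.leadingCoeff, 0, by simpa using h⟩⟩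
        rw [natDegree_mul_X h] at h1; omega
    have hz : D.coeff m = 0 := by
      rw [← coeff_mul_X]; exact coeff_eq_zero_of_natDegree_lt (by omega)
    -- Expand (Q₁(z) + D(z))(z + r) + q₀ and subtract Q(z).
    refine ⟨D * X + r • D + r • Q.divX, ?_, ?_, fun z => ?_⟩
    · refine natDegree_mul_le.trans (add_le_add ?_ natDegree_X_le)
      exact natDegree_add_le_of_degree_le
        (natDegree_add_le_of_degree_le h1 ((natDegree_smul_le _ _).trans hD))
        ((natDegree_smul_le _ _).trans hQ0)
    · rw [coeff_mul_X, coeff_add, coeff_add, coeff_smul, coeff_smul, h2, hz, coeff_divX,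
        smul_zero, add_zero, ← add_smul]
      congr 1; push_cast; ring
    · have hs : ∀ p : R[X], (r • p).eval (z : R) = r • p.eval (z : R) := 
        map_zsmul (AddMonoidHom.mk' (fun p : R[X] => p.eval (z : R)) fun _ _ => eval_add) r
      have hev : ∀ w : R, Q.eval w = Q.divX.eval w * w + Q.coeff 0 := fun w => by
        conv_lhs => rw [← divX_mul_X_add Q]
        rw [eval_add, eval_mul_X, eval_C]
      rw [hev, hev]
      simp only [eval_add, eval_mul_X, h3, hs]
      simp only [zsmul_eq_mul, Int.cast_add, (Int.cast_commute r _).eq]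
      noncomm_ring

/-! ### Finite differences of matrix polynomials -/

section Shift

variable {N : ℕ}

theorem evalAt_eq_eval_intCast (P : (Mat N)[X]) (x : ℕ) :
    evalAt P x = P.eval (((x : ℤ) : Mat N)) := by
  rw [evalAt, Int.cast_natCast]

theorem exists_forward_difference (m : ℕ) (P : (Mat N)[X]) (hP : P.natDegree ≤ m + 1) :
    ∃ D : (Mat N)[X], D.natDegree ≤ m ∧ D.coeff m = ((m : ℂ) + 1) • P.coeff (m + 1) ∧
      ∀ x, evalAt P (x + 1) = evalAt P x + evalAt D x := by
  obtain ⟨D, h1, h2, h3⟩ := exists_shift 1 (m + 1) P hP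
  refine ⟨D, ?_, ?_, fun x => ?_⟩
  · by_cases h : D = 0
    · simp [h]
    · have : Nontrivial (Mat N) := ⟨⟨D.leadingCoeff, 0, by simpa using h⟩⟩
      rw [natDegree_mul_X h] at h1; omega
  · rw [← coeff_mul_X, h2, mul_one, ← Int.cast_smul_eq_zsmul ℂ]
    push_cast; rfl
  · have := h3 x
    simp only [evalAt_eq_eval_intCast]
    exact_mod_cast this

theorem exists_backward_difference (m : ℕ) (P : (Mat N)[X]) (hP : P.natDegree ≤ m) :
    ∃ D : (Mat N)[X], (D * X).natDegree ≤ m ∧ (D * X).coeff m = -((m : ℂ) • P.coeff m) ∧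
      ∀ x, evalAt P x = evalAt P (x + 1) + evalAt D (x + 1) := by
  obtain ⟨D, h1, h2, h3⟩ := exists_shift (-1) m P hP
  refine ⟨D, h1, ?_, fun x => ?_⟩
  · rw [h2, ← Int.cast_smul_eq_zsmul ℂ, ← neg_smul]
    push_cast; rw [mul_neg_one]
  · have := h3 (x + 1)
    rw [add_neg_cancel_right] at this
    simp only [evalAt_eq_eval_intCast]
    exact_mod_cast this

end Shift

/-! ### The inner product -/

section InnerProduct

variable {N : ℕ} {W : ℕ → Mat N}

theorem IsWeight.summable (hW : IsWeight W) (P Q : (Mat N)[X]) :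
    Summable fun x : ℕ => evalAt P x * W x * (evalAt Q x)ᴴ := by
  induction P using Polynomial.induction_on' with
  | add P₁ P₂ h₁ h₂ =>
    simp only [evalAt_add, add_mul]
    exact h₁.add h₂
  | monomial i c =>
    induction Q using Polynomial.induction_on' with
    | add Q₁ Q₂ h₁ h₂ =>
      simp only [evalAt_add, Matrix.conjTranspose_add, mul_add]
      exact h₁.add h₂
    | monomial j d =>
      have h := ((hW.2 (j + i)).mul_left c).mul_right dᴴ
      refine h.congr fun x => ?_
      rw [evalAt_monomial, evalAt_monomial, Matrix.conjTranspose_smul, star_pow, star_natCast,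
        mul_smul_comm, mul_smul_comm, smul_mul_assoc, smul_mul_assoc, smul_mul_assoc, smul_smul,
        pow_add]

theorem innerProd_sub_left (hW : IsWeight W) (P₁ P₂ Q : (Mat N)[X]) :
    innerProd W (P₁ - P₂) Q = innerProd W P₁ Q - innerProd W P₂ Q := by
  simp only [innerProd, evalAt_sub, sub_mul]
  exact (hW.summable P₁ Q).tsum_sub (hW.summable P₂ Q)

theorem innerProd_C_mul_left (hW : IsWeight W) (c : Mat N) (P Q : (Mat N)[X]) :
    innerProd W (C c * P) Q = c * innerProd W P Q := by
  simp only [innerProd, evalAt_mul, evalAt_C, mul_assoc]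
  refine Summable.tsum_mul_left c ?_
  simpa only [mul_assoc] using hW.summable P Q

theorem conjTranspose_innerProd (hW : IsWeight W) (P Q : (Mat N)[X]) :
    (innerProd W P Q)ᴴ = innerProd W Q P := by
  rw [innerProd, innerProd, Matrix.conjTranspose_tsum]
  refine tsum_congr fun x => ?_
  rw [Matrix.conjTranspose_mul, Matrix.conjTranspose_mul, Matrix.conjTranspose_conjTranspose,
    (hW.1 x).isHermitian.eq, mul_assoc]

theorem innerProd_zero_left (Q : (Mat N)[X]) : innerProd W 0 Q = 0 := by
  simp [innerProd, evalAt]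

/-- Summation by parts. -/
theorem innerProd_eq_neg_of_backward {V : ℕ → Mat N} (hW : IsWeight W) (hV : IsWeight V)
    {R Q P D : (Mat N)[X]} (h0 : evalAt R 0 * W 0 = evalAt Q 0 * V 0)
    (hs : ∀ x, evalAt R (x + 1) * W (x + 1) =
      evalAt Q (x + 1) * V (x + 1) - evalAt Q x * V x)
    (hD : ∀ x, evalAt P (x + 1) = evalAt P x + evalAt D x) :
    innerProd W R P = -innerProd V Q D := by
  have s1 := hV.summable Q P
  have s2 := hV.summable Q D
  have s3 := (summable_nat_add_iff 1).2 s1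
  have e : ∀ x, evalAt R (x + 1) * W (x + 1) * (evalAt P (x + 1))ᴴ =
      evalAt Q (x + 1) * V (x + 1) * (evalAt P (x + 1))ᴴ -
        (evalAt Q x * V x * (evalAt P x)ᴴ + evalAt Q x * V x * (evalAt D x)ᴴ) := fun x => by
    rw [hs, sub_mul, ← mul_add, ← Matrix.conjTranspose_add, ← hD]
  rw [innerProd, (hW.summable R P).tsum_eq_zero_add, h0, tsum_congr e,
    s3.tsum_sub (s1.add s2), s1.tsum_add s2, innerProd, s1.tsum_eq_zero_add]
  abel

/-- A sequence of polynomials dual to the powers of `x` gives the monic orthogonal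
polynomials. -/
theorem isMonicMVOP_of_dual [Nonempty (Fin N)] (hW : IsWeight W) {R : ℕ → (Mat N)[X]}
    {K : ℕ → Mat N}
    (hdeg : ∀ n, (R n).natDegree ≤ n) (hG : ∀ n, IsUnit ((R n).coeff n))
    (hR : ∀ n P, P.natDegree ≤ n → innerProd W (R n) P = K n * (P.coeff n)ᴴ) :
    IsMonicMVOP W fun n => C ((R n).coeff n)⁻¹ * R n := by
  have hm : ∀ n, (C ((R n).coeff n)⁻¹ * R n).coeff n = 1 := fun n => by
    rw [coeff_C_mul, Matrix.nonsing_inv_mul _ ((Matrix.isUnit_iff_isUnit_det _).1 (hG n))]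
  have hd : ∀ n, (C ((R n).coeff n)⁻¹ * R n).natDegree ≤ n := fun n =>
    (natDegree_C_mul_le _ _).trans (hdeg n)
  have hlt : ∀ m n, m < n → innerProd W (C ((R n).coeff n)⁻¹ * R n)
      (C ((R m).coeff m)⁻¹ * R m) = 0 := fun m n hmn => by
    rw [innerProd_C_mul_left hW, hR n _ ((hd m).trans hmn.le),
      coeff_eq_zero_of_natDegree_lt ((hd m).trans_lt hmn), Matrix.conjTranspose_zero, mul_zero,
      mul_zero]
  refine ⟨fun n => ⟨monic_of_natDegree_le_of_coeff_eq_one n (hd n) (hm n), ?_⟩,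
    fun m n hmn => ?_⟩
  · refine le_antisymm (hd n) (le_natDegree_of_ne_zero ?_)
    simp only [hm]; exact one_ne_zero
  · rcases lt_or_gt_of_ne hmn with h | h
    · have := hlt m n h
      rw [← conjTranspose_innerProd hW]
      simp only [this, Matrix.conjTranspose_zero]
    · exact hlt n m h

/-- Subtracting Q_k P_k, with Q_k the coefficient of x^k acting from the left, lowers the degree.
The bound uses `degree`, so that k = 0 forces Q = 0. -/
theorem IsMonicMVOP.innerProd_eq_zero (hW : IsWeight W) {P : ℕ → (Mat N)[X]}
    (hP : IsMonicMVOP W P) {n : ℕ} (k : ℕ) (hk : k ≤ n) (Q : (Mat N)[X])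
    (hQ : Q.degree < k) : innerProd W Q (P n) = 0 := by
  induction k generalizing Q with
  | zero =>
    have : Q = 0 := by
      rw [← degree_eq_bot]
      exact Nat.WithBot.lt_zero_iff.1 (by simpa using hQ)
    rw [this, innerProd_zero_left]
  | succ k ih =>
    have hlead : (P k).coeff k = 1 := by
      have := (hP.1 k).1.coeff_natDegree
      rwa [(hP.1 k).2] at this
    have h1 : (Q - C (Q.coeff k) * P k).degree < k := by
      rw [degree_lt_iff_coeff_zero]
      intro i hi
      rcases hi.eq_or_lt with rfl | hi
      · rw [coeff_sub, coeff_C_mul, hlead, mul_one, sub_self]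
      · rw [coeff_sub, coeff_C_mul,
          coeff_eq_zero_of_natDegree_lt (p := P k) (by rw [(hP.1 k).2]; exact hi), mul_zero,
          sub_zero]
        exact coeff_eq_zero_of_degree_lt (hQ.trans_le (by exact_mod_cast hi))
    have h2 := ih (by omega) _ h1
    rwa [innerProd_sub_left hW, innerProd_C_mul_left hW, hP.2 k n (by omega), mul_zero,
      sub_zero] at h2

/-- The difference of two candidates has some degree d < n, hence is orthogonal to R_d. That pairing
is K_d times the adjoint of its leading coefficient, and K_d is invertible. -/
theorem IsMonicMVOP.eq_of_dual (hW : IsWeight W) {R : ℕ → (Mat N)[X]}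
    {K : ℕ → Mat N} (hdeg : ∀ n, (R n).natDegree ≤ n)
    (hK : ∀ n, IsUnit (K n))
    (hR : ∀ n P, P.natDegree ≤ n → innerProd W (R n) P = K n * (P.coeff n)ᴴ)
    {P P' : ℕ → (Mat N)[X]} (hP : IsMonicMVOP W P) (hP' : IsMonicMVOP W P') : P = P' := by
  funext n
  by_contra hne
  set D := P n - P' n with hD
  have hD0 : D ≠ 0 := sub_ne_zero.2 hne
  have hlead : ∀ {P : ℕ → (Mat N)[X]}, IsMonicMVOP W P → (P n).coeff n = 1 := fun hP => by
    have := (hP.1 n).1.coeff_natDegree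
    rwa [(hP.1 n).2] at this
  have hdegD : D.degree < n := by
    rw [degree_lt_iff_coeff_zero]
    intro i hi
    rcases hi.eq_or_lt with rfl | hi
    · rw [hD, coeff_sub, hlead hP, hlead hP', sub_self]
    · rw [hD, coeff_sub, coeff_eq_zero_of_natDegree_lt (by rw [(hP.1 n).2]; exact hi),
        coeff_eq_zero_of_natDegree_lt (by rw [(hP'.1 n).2]; exact hi), sub_zero]
  have hd : D.natDegree < n := (natDegree_lt_iff_degree_lt hD0).2 hdegD
  have hRd : (R D.natDegree).degree < n :=
    (degree_le_of_natDegree_le (hdeg _)).trans_lt (by exact_mod_cast hd)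
  have h1 : innerProd W (R D.natDegree) D = 0 := by
    rw [← conjTranspose_innerProd hW, innerProd_sub_left hW,
      ← conjTranspose_innerProd hW (R _), ← conjTranspose_innerProd hW (R _),
      hP.innerProd_eq_zero hW n le_rfl _ hRd, hP'.innerProd_eq_zero hW n le_rfl _ hRd, sub_self,
      Matrix.conjTranspose_zero]
  rw [hR _ D le_rfl, (hK _).mul_right_eq_zero, Matrix.conjTranspose_eq_zero] at h1
  exact hD0 (leadingCoeff_eq_zero.1 h1)

end InnerProduct

/-! ### Exponential series for two-sided multiplications -/

section TwoSided

/-- The factor ‖1‖ is needed at n = 0, since the norm of the identity is not assumed to be 1. -/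
theorem norm_pow_le_mul {𝔸 : Type*} [NormedRing 𝔸] (A : 𝔸) (n : ℕ) :
    ‖A ^ n‖ ≤ ‖(1 : 𝔸)‖ * ‖A‖ ^ n := by
  induction n with
  | zero => simp
  | succ n ih =>
    rw [pow_succ, pow_succ, ← mul_assoc]
    exact (norm_mul_le _ _).trans (by gcongr)

variable {𝔸 : Type*} [NormedRing 𝔸] [NormedAlgebra ℂ 𝔸]

theorem mulLeftRight_pow_apply (A B X : 𝔸) (n : ℕ) :
    ((ContinuousLinearMap.mulLeftRight ℂ 𝔸 A B) ^ n) X = A ^ n * X * B ^ n := by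
  induction n with
  | zero => simp
  | succ n ih =>
    rw [pow_succ', _root_.mul_apply_eq_comp, ih,
      ContinuousLinearMap.mulLeftRight_apply, pow_succ', pow_succ]
    simp only [mul_assoc]

variable [CompleteSpace 𝔸]

theorem hasSum_exp_mulLeftRight (a : ℂ) (A B X : 𝔸) :
    HasSum (fun n : ℕ => (a ^ n / (n ! : ℂ)) • (A ^ n * X * B ^ n))
      (NormedSpace.exp (a • ContinuousLinearMap.mulLeftRight ℂ 𝔸 A B) X) := by
  have h := NormedSpace.exp_series_hasSum_exp' (𝕂 := ℂ)
    (a • ContinuousLinearMap.mulLeftRight ℂ 𝔸 A B)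
  have h2 := (ContinuousLinearMap.apply ℂ 𝔸 X).hasSum h
  refine h2.congr_fun fun n => ?_
  simp only [ContinuousLinearMap.apply_apply, _root_.smul_apply, _root_.smul_pow,
    mulLeftRight_pow_apply, smul_smul]
  rw [div_eq_inv_mul]

/-- (1+A)X(1+B) = X + AX + XB + AXB is a sum of four commuting operators on X, so its exponential
factors; A and B need not commute with each other. -/
theorem hasSum_two_sided (a : ℂ) (A B X Y : 𝔸)
    (hY : HasSum (fun n : ℕ => (a ^ n / (n ! : ℂ)) • (A ^ n * X * B ^ n)) Y) :
    HasSum (fun n : ℕ => (a ^ n / (n ! : ℂ)) • ((1 + A) ^ n * X * (1 + B) ^ n))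
      (Complex.exp a • (NormedSpace.exp (a • A) * Y * NormedSpace.exp (a • B))) := by
  let _ : NormedAlgebra ℚ (𝔸 →L[ℂ] 𝔸) := NormedAlgebra.restrictScalars ℚ ℂ _
  set Ψ : 𝔸 → 𝔸 → 𝔸 →L[ℂ] 𝔸 := fun C D => ContinuousLinearMap.mulLeftRight ℂ 𝔸 C D with hΨ
  have hcomm : ∀ C D C' D', Commute C C' → Commute D D' → Commute (a • Ψ C D) (a • Ψ C' D') := by
    intro C D C' D' h1 h2
    ext X
    simp only [hΨ, _root_.mul_apply_eq_comp, _root_.smul_apply,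
      ContinuousLinearMap.mulLeftRight_apply, mul_smul_comm, smul_mul_assoc]
    rw [← mul_assoc, ← mul_assoc, h1.eq, mul_assoc _ D', ← h2.eq]
    simp only [mul_assoc]
  have hsplit : a • Ψ (1 + A) (1 + B) = a • Ψ 1 1 + (a • Ψ A 1 + (a • Ψ 1 B + a • Ψ A B)) := by
    ext X
    simp only [hΨ, _root_.smul_apply, _root_.add_apply,
      ContinuousLinearMap.mulLeftRight_apply, ← smul_add]
    congr 1
    noncomm_ring
  have h1 : Commute A 1 := Commute.one_right A
  have h1' : Commute 1 A := Commute.one_left A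
  have h2 : Commute 1 B := Commute.one_left B
  have h3 : Commute (1 : 𝔸) 1 := Commute.one_left 1
  have hexp : NormedSpace.exp (a • Ψ (1 + A) (1 + B)) X =
      NormedSpace.exp (a • Ψ 1 1) (NormedSpace.exp (a • Ψ A 1) (NormedSpace.exp (a • Ψ 1 B)
        (NormedSpace.exp (a • Ψ A B) X))) := by
    rw [hsplit, NormedSpace.exp_add_of_commute, NormedSpace.exp_add_of_commute,
      NormedSpace.exp_add_of_commute]
    · rfl
    · exact hcomm _ _ _ _ h1' (Commute.refl B)
    · exact (hcomm _ _ _ _ h1 h2).add_right (hcomm _ _ _ _ (Commute.refl A) h2)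
    · exact (hcomm _ _ _ _ h1' h3).add_right
        ((hcomm _ _ _ _ h3 h2).add_right (hcomm _ _ _ _ h1' h2))
  have eAB : NormedSpace.exp (a • Ψ A B) X = Y := (hasSum_exp_mulLeftRight a A B X).unique hY
  have eL : ∀ Z, NormedSpace.exp (a • Ψ A 1) Z = NormedSpace.exp (a • A) * Z := fun Z => by
    refine (hasSum_exp_mulLeftRight a A 1 Z).unique ?_
    refine ((NormedSpace.exp_series_hasSum_exp' (𝕂 := ℂ) (a • A)).mul_right Z).congr_fun
      fun n => ?_
    rw [one_pow, mul_one, _root_.smul_pow, smul_smul, div_eq_inv_mul, smul_mul_assoc]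
  have eR : ∀ Z, NormedSpace.exp (a • Ψ 1 B) Z = Z * NormedSpace.exp (a • B) := fun Z => by
    refine (hasSum_exp_mulLeftRight a 1 B Z).unique ?_
    refine ((NormedSpace.exp_series_hasSum_exp' (𝕂 := ℂ) (a • B)).mul_left Z).congr_fun
      fun n => ?_
    rw [one_pow, one_mul, _root_.smul_pow, smul_smul, div_eq_inv_mul, mul_smul_comm]
  have e1 : ∀ Z, NormedSpace.exp (a • Ψ 1 1) Z = Complex.exp a • Z := fun Z => by
    refine (hasSum_exp_mulLeftRight a 1 1 Z).unique ?_
    have := (NormedSpace.exp_series_hasSum_exp' (𝕂 := ℂ) a).smul_const Z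
    rw [← Complex.exp_eq_exp_ℂ] at this
    refine this.congr_fun fun n => ?_
    rw [one_pow, one_mul, mul_one, div_eq_inv_mul, smul_eq_mul]
  have h := hasSum_exp_mulLeftRight a (1 + A) (1 + B) X
  rw [show ContinuousLinearMap.mulLeftRight ℂ 𝔸 (1 + A) (1 + B) = Ψ (1 + A) (1 + B) from rfl,
    hexp, eAB, eR, eL, e1, ← mul_assoc] at h
  exact h

theorem summable_moment_two_sided (a : ℂ) (A B X : 𝔸) (k : ℕ) :
    Summable fun n : ℕ => ((n : ℂ) ^ k) • ((a ^ n / (n ! : ℂ)) • (A ^ n * X * B ^ n)) := by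
  have hs := (Real.summable_pow_div_factorial
    (Real.exp 1 * ‖a‖ * ‖A‖ * ‖B‖)).mul_left ((k ! : ℝ) * ‖(1 : 𝔸)‖ ^ 2 * ‖X‖)
  refine Summable.of_norm_bounded hs fun n => ?_
  -- This bound absorbs the moment into a geometric factor, leaving an exponential series.
  have h1 : (n : ℝ) ^ k ≤ (k ! : ℝ) * Real.exp 1 ^ n := by
    have := Real.pow_div_factorial_le_exp (n : ℝ) (by positivity) k
    rw [div_le_iff₀ (by positivity), ← mul_one (n : ℝ), Real.exp_nat_mul, mul_one] at this
    linarith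
  have h2 := norm_pow_le_mul A n
  have h3 := norm_pow_le_mul B n
  have h4 : ‖A ^ n * X * B ^ n‖ ≤ (‖(1 : 𝔸)‖ * ‖A‖ ^ n) * ‖X‖ * (‖(1 : 𝔸)‖ * ‖B‖ ^ n) :=
    (norm_mul_le _ _).trans (mul_le_mul ((norm_mul_le _ _).trans (by gcongr)) h3
      (norm_nonneg _) (by positivity))
  rw [norm_smul, norm_smul, norm_pow, norm_div, norm_pow, Complex.norm_natCast,
    Complex.norm_natCast]
  calc (n : ℝ) ^ k * (‖a‖ ^ n / (n ! : ℝ) * ‖A ^ n * X * B ^ n‖)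
      ≤ ((k ! : ℝ) * Real.exp 1 ^ n) * (‖a‖ ^ n / (n ! : ℝ) *
        ((‖(1 : 𝔸)‖ * ‖A‖ ^ n) * ‖X‖ * (‖(1 : 𝔸)‖ * ‖B‖ ^ n))) := by gcongr
    _ = _ := by simp only [mul_pow]; ring

end TwoSided

/-! ### The weight -/

section Weight

variable {N : ℕ} {a : ℝ} {μ : Fin N → ℝ} {δ : ℕ → Fin N → ℝ}

theorem one_add_conjTranspose_pow (n : ℕ) :
    (1 + (matA μ)ᴴ) ^ n = ((1 + matA μ) ^ n)ᴴ := by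
  rw [Matrix.conjTranspose_pow, Matrix.conjTranspose_add, Matrix.conjTranspose_one]

theorem delta_pos (ha : 0 < a) (hpar : ParameterChoice a μ δ) (lam : ℕ) (k : Fin N) :
    0 < δ lam k := by
  rw [hpar.2]; positivity

open scoped Matrix.Norms.Operator in
theorem isWeight_weight (ha : 0 < a) (hμ : ∀ j, 0 < μ j) (hpar : ParameterChoice a μ δ)
    (lam : ℕ) : IsWeight (weight a μ δ lam) := by
  refine ⟨fun x => ?_, fun k => ?_⟩
  · rw [weight, one_add_conjTranspose_pow]
    have hT : (matT (δ lam)).PosDef := Matrix.PosDef.diagonal fun k =>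
      Complex.zero_lt_real.2 (delta_pos ha hpar lam k)
    have h1 := hT.mul_mul_conjTranspose_same
      (Matrix.vecMul_injective_of_isUnit ((isUnit_one_add_matA hμ).pow (x + lam)))
    have h2 : (0 : ℂ) < (a : ℂ) ^ x / (x ! : ℂ) := by
      have : (0 : ℝ) < a ^ x / (x ! : ℝ) := by positivity
      exact_mod_cast this
    exact h1.smul h2
  · have h := summable_moment_two_sided (a : ℂ) (1 + matA μ) (1 + (matA μ)ᴴ)
      ((1 + matA μ) ^ lam * matT (δ lam) * (1 + (matA μ)ᴴ) ^ lam) k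
    refine h.congr fun x => ?_
    rw [weight, pow_add (1 + matA μ), add_comm x lam, pow_add (1 + (matA μ)ᴴ)]
    simp only [mul_assoc]

/-- The matrix `exp (a A) (I + A) ^ k`. -/
def matF (a : ℝ) (μ : Fin N → ℝ) (k : ℕ) : Mat N :=
  NormedSpace.exp ((a : ℂ) • matA μ) * (1 + matA μ) ^ k

open scoped Matrix.Norms.Operator in
theorem tsum_weight (lam : ℕ) (Y : Mat N)
    (hY : HasSum (fun n : ℕ => ((a : ℂ) ^ n / (n ! : ℂ)) •
      (matA μ ^ n * matT (δ lam) * (matA μ)ᴴ ^ n)) Y) :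
    ∑' x, weight a μ δ lam x =
      (Real.exp a : ℂ) • (matF a μ lam * Y * (matF a μ lam)ᴴ) := by
  have h := hasSum_two_sided (a : ℂ) (matA μ) (matA μ)ᴴ _ Y hY
  have h2 := (h.mul_left ((1 + matA μ) ^ lam)).mul_right ((1 + (matA μ)ᴴ) ^ lam)
  have e : (1 + matA μ) ^ lam * NormedSpace.exp ((a : ℂ) • matA μ) = matF a μ lam := by
    rw [matF]
    refine (Commute.exp_right (Commute.smul_right ?_ _)).eq
    exact ((Commute.one_left _).add_left (Commute.refl (matA μ))).pow_left lam
  have e' : NormedSpace.exp ((a : ℂ) • (matA μ)ᴴ) * (1 + (matA μ)ᴴ) ^ lam = (matF a μ lam)ᴴ := by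
    rw [← e, Matrix.conjTranspose_mul, ← Matrix.exp_conjTranspose, Matrix.conjTranspose_smul,
      one_add_conjTranspose_pow, Complex.star_def, Complex.conj_ofReal]
  rw [← e', ← e, Complex.ofReal_exp]
  have e3 : (1 + matA μ) ^ lam * (Complex.exp a • (NormedSpace.exp ((a : ℂ) • matA μ) * Y *
      NormedSpace.exp ((a : ℂ) • (matA μ)ᴴ))) * (1 + (matA μ)ᴴ) ^ lam =
      Complex.exp a • ((1 + matA μ) ^ lam * NormedSpace.exp ((a : ℂ) • matA μ) * Y *
        (NormedSpace.exp ((a : ℂ) • (matA μ)ᴴ) * (1 + (matA μ)ᴴ) ^ lam)) := by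
    simp only [mul_smul_comm, smul_mul_assoc, mul_assoc]
  rw [← e3]
  refine (h2.congr_fun fun x => ?_).tsum_eq
  rw [weight, add_comm x lam, pow_add (1 + matA μ), add_comm lam x, pow_add (1 + (matA μ)ᴴ)]
  simp only [mul_smul_comm, smul_mul_assoc, mul_assoc]

end Weight

/-! ### The matrices `L(0)` and `exp (a A) (I + A) ^ k` -/

section Factor

variable {N : ℕ} {a : ℝ} {μ : Fin N → ℝ}

theorem charlier_zero (n : ℕ) : charlier a n 0 = 1 := by
  rw [charlier, Finset.sum_eq_single 0]
  · simp [poch]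
  · intro k _ hk
    simp [poch, hk]
  · simp

-- Since c_n(0) = 1, the entries of L(0) are those of the exponential series, which stops because A
-- is nilpotent.
open scoped Matrix.Norms.Operator in
theorem matL_zero (hμ : ∀ j, 0 < μ j) :
    matL a μ 0 = NormedSpace.exp (-((a : ℂ) • matA μ)) := by
  rw [← neg_smul, NormedSpace.exp_eq_tsum ℂ]
  simp only [_root_.smul_pow]
  rw [tsum_eq_sum (s := Finset.range N)]
  · ext j k
    rw [Matrix.sum_apply]
    simp only [Matrix.smul_apply, matA_pow_apply hμ, smul_eq_mul]
    by_cases h : k ≤ j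
    · have hjk : (k : ℕ) ≤ j := h
      rw [Finset.sum_eq_single ((j : ℕ) - k)]
      · rw [if_pos (by omega)]
        simp only [matL, Matrix.of_apply, if_pos h, charlier_zero]
        ring
      · intro i _ hi
        rw [if_neg (by omega)]; simp
      · intro hi
        exact absurd (Finset.mem_range.2 (by have := j.2; omega)) hi
    · have hjk : ¬ (k : ℕ) ≤ j := h
      rw [Finset.sum_eq_zero]
      · simp [matL, h]
      · intro i _
        rw [if_neg (by omega)]; simp
  · intro i hi
    rw [matA_pow_eq_zero hμ (by simpa using hi)]; simp

theorem isUnit_matF (hμ : ∀ j, 0 < μ j) (k : ℕ) : IsUnit (matF a μ k) :=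
  (Matrix.isUnit_exp _).mul ((isUnit_one_add_matA hμ).pow k)

theorem matF_inv (hμ : ∀ j, 0 < μ j) (k : ℕ) :
    matL a μ 0 * ((1 + matA μ) ^ k)⁻¹ = (matF a μ k)⁻¹ := by
  have h : (1 + matA μ) ^ k * NormedSpace.exp ((a : ℂ) • matA μ) = matF a μ k := by
    rw [matF]
    refine (Commute.exp_right (Commute.smul_right ?_ _)).eq
    exact ((Commute.one_left _).add_left (Commute.refl (matA μ))).pow_left k
  rw [matL_zero hμ, Matrix.exp_neg, ← h, Matrix.mul_inv_rev]

-- With Z = aA, sum JZⁿ = ZⁿJ + nZⁿ against 1/n!; the last term contributes Z exp Z.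
open scoped Matrix.Norms.Operator in
theorem exp_mul_matJ :
    NormedSpace.exp ((a : ℂ) • matA μ) * matJ N =
      (matJ N - (a : ℂ) • matA μ) * NormedSpace.exp ((a : ℂ) • matA μ) := by
  set Z := (a : ℂ) • matA μ with hZ
  have hJZ : matJ N * Z = Z * matJ N + Z := by
    rw [hZ, mul_smul_comm, matJ_mul_matA, smul_add, smul_mul_assoc]
  clear_value Z
  have hpow : ∀ n : ℕ, matJ N * Z ^ n = Z ^ n * matJ N + (n : ℂ) • Z ^ n := by
    intro n
    induction n with
    | zero => simp
    | succ n ih =>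
      rw [pow_succ, ← mul_assoc, ih, add_mul, mul_assoc, hJZ]
      push_cast
      simp only [mul_add, add_smul, one_smul, mul_assoc, smul_mul_assoc]
      abel
  have h := NormedSpace.exp_series_hasSum_exp' (𝕂 := ℂ) Z
  have h1 : HasSum (fun n : ℕ => ((n ! : ℂ)⁻¹ * n) • Z ^ n) (Z * NormedSpace.exp Z) := by
    rw [← add_zero (Z * NormedSpace.exp Z)]
    have h0 : (0 : Mat N) = ∑ i ∈ Finset.range 1, ((i ! : ℂ)⁻¹ * i) • Z ^ i := by simp
    rw [h0]
    refine (hasSum_nat_add_iff 1).1 ((h.mul_left Z).congr_fun fun n => ?_)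
    rw [mul_smul_comm, ← pow_succ', Nat.factorial_succ]
    congr 1
    have h2 : ((n : ℂ) + 1) ≠ 0 := by exact_mod_cast Nat.succ_ne_zero n
    push_cast
    field_simp
  have h2 : HasSum (fun n : ℕ => ((n ! : ℂ)⁻¹) • (matJ N * Z ^ n))
      (NormedSpace.exp Z * matJ N + Z * NormedSpace.exp Z) := by
    refine ((h.mul_right (matJ N)).add h1).congr_fun fun n => ?_
    rw [hpow, smul_add, smul_smul, smul_mul_assoc]
  have h3 : HasSum (fun n : ℕ => ((n ! : ℂ)⁻¹) • (matJ N * Z ^ n))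
      (matJ N * NormedSpace.exp Z) :=
    (h.mul_left (matJ N)).congr_fun fun n => by rw [mul_smul_comm]
  rw [sub_mul, eq_sub_iff_add_eq]
  exact h2.unique h3

/-- Diagonalizes the matrix J − aA − kM that appears in the leading coefficient of the raising
operator. -/
theorem matF_mul_matJ (hμ : ∀ j, 0 < μ j) (k : ℕ) :
    matF a μ k * matJ N =
      (matJ N - (a : ℂ) • matA μ - (k : ℂ) • matM μ) * matF a μ k := by
  have hA : NormedSpace.exp ((a : ℂ) • matA μ) * matA μ =
      matA μ * NormedSpace.exp ((a : ℂ) • matA μ) :=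
    (Commute.exp_right (Commute.smul_right (Commute.refl (matA μ)) _)).eq.symm
  have hM : NormedSpace.exp ((a : ℂ) • matA μ) * matM μ =
      matM μ * NormedSpace.exp ((a : ℂ) • matA μ) := by
    refine (isUnit_one_add_matA hμ).mul_right_cancel ?_
    rw [mul_assoc, matM_mul hμ, mul_assoc, mul_add (NormedSpace.exp _), mul_one, hA]
    rw [← one_add_mul (matA μ) (NormedSpace.exp _), ← mul_assoc, matM_mul hμ]
  rw [matF, mul_assoc, pow_mul_matJ hμ, ← mul_assoc, mul_sub, exp_mul_matJ, mul_smul_comm, hM,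
    ← mul_assoc, sub_mul (matJ N - (a : ℂ) • matA μ), smul_mul_assoc]

end Factor

/-! ### The Rodrigues formula -/

section Rodrigues

variable {N : ℕ} {a : ℝ} {μ : Fin N → ℝ} {δ : ℕ → Fin N → ℝ}

theorem exists_raising (ha : 0 < a) (hμ : ∀ j, 0 < μ j) (hpar : ParameterChoice a μ δ)
    (lam m : ℕ) (Q : (Mat N)[X]) (hQ : Q.natDegree ≤ m) :
    ∃ R : (Mat N)[X], R.natDegree ≤ m + 1 ∧
      R.coeff (m + 1) = Q.coeff m * ((-1 / 2 : ℂ) • (((N + lam + 1 : ℕ) : ℂ) • (1 : Mat N) -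
        (matJ N - (a : ℂ) • matA μ - ((lam + m + 1 : ℕ) : ℂ) • matM μ))) ∧
      evalAt R 0 * weight a μ δ lam 0 = evalAt Q 0 * weight a μ δ (lam + 1) 0 ∧
      ∀ x, evalAt R (x + 1) * weight a μ δ lam (x + 1) =
        evalAt Q (x + 1) * weight a μ δ (lam + 1) (x + 1) -
          evalAt Q x * weight a μ δ (lam + 1) x := by
  obtain ⟨D, hD1, hD2, hD3⟩ := exists_backward_difference m Q hQ
  -- With S(x) = S₀ + xS₁, the shifted weight W^{(λ+1)}(x−1) is xS(x)W^{(λ)}(x). Both Φ(x+λ) and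
  -- xS(x) have x² coefficient −M/2, so their difference is the linear E₀ + xE₁. As Q(x−1) = Q(x) +
  -- D(x), the raised polynomial is QE − xDS.
  set E₀ : Mat N := pearsonPhi a μ lam lam with hE₀
  set E₁ : Mat N := matH N - ((2 * (lam : ℂ) + 1) / 2) • matM μ - ((a : ℂ) / 2) • matA μ -
    (1 / 2 : ℂ) • ((lam : ℂ) • 1 + matJ N) + ((lam : ℂ) / 2) • matM μ with hE₁
  set S₀ : Mat N := (1 / 2 : ℂ) • ((lam : ℂ) • 1 + matJ N - (lam : ℂ) • matM μ) with hS₀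
  set S₁ : Mat N := (-1 / 2 : ℂ) • matM μ with hS₁
  have hlin : ∀ x : ℕ, E₀ + ((x : ℂ) • E₁) + (x : ℂ) • (S₀ + (x : ℂ) • S₁) =
      pearsonPhi a μ lam ((x : ℂ) + lam) := fun x => by
    rw [hE₀, hE₁, hS₀, hS₁, pearsonPhi, pearsonPhi]
    module
  have hevE : ∀ x : ℕ, evalAt (C E₀ + C E₁ * X) x = E₀ + (x : ℂ) • E₁ := fun x => by
    rw [evalAt_add, evalAt_mul, evalAt_C, evalAt_C, evalAt_X, mul_smul_comm, mul_one]
  have hevS : ∀ x : ℕ, evalAt (C S₀ + C S₁ * X) x = S₀ + (x : ℂ) • S₁ := fun x => by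
    rw [evalAt_add, evalAt_mul, evalAt_C, evalAt_C, evalAt_X, mul_smul_comm, mul_one]
  have hevD : ∀ x : ℕ, evalAt (D * X) x = (x : ℂ) • evalAt D x := fun x => by
    rw [evalAt_mul, evalAt_X, mul_smul_comm, mul_one]
  have hdeg : ∀ c d : Mat N, (C c + C d * X).natDegree ≤ 1 := fun c d => by
    refine natDegree_add_le_of_degree_le (by simp) ?_
    exact (natDegree_C_mul_le _ _).trans natDegree_X_le
  have hcoeff : ∀ (T : (Mat N)[X]) (c d : Mat N), T.natDegree ≤ m →
      (T * (C c + C d * X)).coeff (m + 1) = T.coeff m * d := fun T c d hT => by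
    rw [mul_add, coeff_add, coeff_mul_C, ← mul_assoc, coeff_mul_X, coeff_mul_C,
      coeff_eq_zero_of_natDegree_lt (Nat.lt_succ_of_le hT), zero_mul, zero_add]
  refine ⟨Q * (C E₀ + C E₁ * X) - (D * X) * (C S₀ + C S₁ * X), ?_, ?_, ?_, fun x => ?_⟩
  · exact (natDegree_sub_le_of_le (natDegree_mul_le.trans (add_le_add hQ (hdeg _ _)))
      (natDegree_mul_le.trans (add_le_add hD1 (hdeg _ _)))).trans (max_self _).le
  · rw [coeff_sub, hcoeff _ _ _ hQ, hcoeff _ _ _ hD1, hD2, neg_mul, sub_neg_eq_add,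
      smul_mul_assoc, ← mul_smul_comm, ← mul_add]
    congr 1
    rw [hE₁, hS₁, matH]
    push_cast
    module
  · rw [evalAt_sub, evalAt_mul, evalAt_mul, hevE, hevD, weight_succ ha hμ hpar]
    simp [hE₀, mul_assoc]
  · have e : evalAt Q x * weight a μ δ (lam + 1) x =
        (evalAt Q (x + 1) + evalAt D (x + 1)) * ((((x + 1 : ℕ) : ℂ)) •
          ((S₀ + ((x + 1 : ℕ) : ℂ) • S₁) * weight a μ δ lam (x + 1))) := by
      rw [hD3, weight_succ_shift ha hμ hpar, ← smul_mul_assoc, ← smul_mul_assoc]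
      congr 2
      rw [hS₀, hS₁]
      module
    rw [e, weight_succ ha hμ hpar, ← hlin, evalAt_sub, evalAt_mul, evalAt_mul, hevE, hevS, hevD]
    simp only [sub_mul, add_mul, mul_add, smul_mul_assoc, mul_smul_comm, mul_assoc, smul_add]
    abel

theorem matLam_eq_diagonal (N lam n : ℕ) :
    matLam N lam n = Matrix.diagonal fun i : Fin N =>
      (((N + lam + n - (i + 1)) ! : ℂ) / ((N + lam - (i + 1)) ! : ℂ)) := by
  have hf : ∀ k : ℕ, ((k ! : ℕ) : ℂ) ≠ 0 := fun k => by
    exact_mod_cast (Nat.factorial_pos k).ne'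
  induction n with
  | zero =>
    simp [matLam, hf]
  | succ n ih =>
    have : matLam N lam (n + 1) =
        matLam N lam n * (((N + lam + (n + 1) : ℕ) : ℂ) • (1 : Mat N) - matJ N) := by
      simp [matLam, List.range_succ]
    rw [this, ih, matJ, Matrix.smul_one_eq_diagonal, Matrix.diagonal_sub,
      Matrix.diagonal_mul_diagonal]
    congr 1
    funext i
    have hi := i.2
    obtain ⟨p, hp⟩ : ∃ p, N + lam + n = p + (i + 1) :=
      ⟨N + lam + n - (i + 1), by omega⟩
    have e1 : N + lam + n - ((i : ℕ) + 1) = p := by omega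
    have e2 : N + lam + (n + 1) - ((i : ℕ) + 1) = p + 1 := by omega
    have e3 : N + lam + (n + 1) = p + 1 + (i + 1) := by omega
    rw [e1, e2, e3, Nat.factorial_succ]
    push_cast
    ring

/-- Splits off the factor m = 1, not the last one, because the Rodrigues recursion raises λ while
lowering n. -/
theorem matLam_succ (N lam n : ℕ) :
    matLam N lam (n + 1) =
      matLam N (lam + 1) n * (((N + lam + 1 : ℕ) : ℂ) • (1 : Mat N) - matJ N) := by
  rw [matLam_eq_diagonal, matLam_eq_diagonal, matJ, Matrix.smul_one_eq_diagonal,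
    Matrix.diagonal_sub, Matrix.diagonal_mul_diagonal]
  congr 1
  funext i
  have hi := i.2
  obtain ⟨p, hp⟩ : ∃ p, N + lam = p + (i + 1) := ⟨N + lam - (i + 1), by omega⟩
  have e1 : N + lam - ((i : ℕ) + 1) = p := by omega
  have e2 : N + (lam + 1) - ((i : ℕ) + 1) = p + 1 := by omega
  have e3 : N + lam + 1 = p + 1 + (i + 1) := by omega
  have e4 : N + (lam + 1) + n = N + lam + (n + 1) := by omega
  rw [e1, e2, e3, e4, Nat.factorial_succ]
  have h1 : ((p ! : ℕ) : ℂ) ≠ 0 := by exact_mod_cast (Nat.factorial_pos p).ne'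
  have h2 : ((p : ℂ) + 1) ≠ 0 := by exact_mod_cast Nat.succ_ne_zero p
  push_cast
  field_simp
  ring

theorem isUnit_matLam (N lam n : ℕ) : IsUnit (matLam N lam n) := by
  have hf : ∀ k : ℕ, ((k ! : ℕ) : ℂ) ≠ 0 := fun k => by
    exact_mod_cast (Nat.factorial_pos k).ne'
  rw [matLam_eq_diagonal, Matrix.isUnit_iff_isUnit_det, Matrix.det_diagonal]
  exact (Finset.prod_ne_zero_iff.2 fun i _ => div_ne_zero (hf _) (hf _)).isUnit

/-- Each summation by parts replaces P by its forward difference and λ by λ + 1. As n + (λ+1) =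
(n+1) + λ, every stage is conjugated by the same F, so the leading coefficients multiply to a
conjugate of Λ. -/
theorem exists_rodrigues (ha : 0 < a) (hμ : ∀ j, 0 < μ j) (hpar : ParameterChoice a μ δ)
    (n lam : ℕ) :
    ∃ R : (Mat N)[X], R.natDegree ≤ n ∧
      R.coeff n = ((-1 / 2 : ℂ) ^ n) •
        (matF a μ (n + lam) * matLam N lam n * (matF a μ (n + lam))⁻¹) ∧
      ∀ P : (Mat N)[X], P.natDegree ≤ n → innerProd (weight a μ δ lam) R P =
        ((-1) ^ n * (n ! : ℂ)) • ((∑' x, weight a μ δ (lam + n) x) * (P.coeff n)ᴴ) := by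
  have hdet : ∀ k, IsUnit (matF a μ k).det := fun k =>
    (Matrix.isUnit_iff_isUnit_det _).1 (isUnit_matF hμ k)
  induction n generalizing lam with
  | zero =>
    refine ⟨1, by simp, ?_, fun P hP => ?_⟩
    · simp [matLam, Matrix.mul_nonsing_inv _ (hdet _)]
    · have hW := isWeight_weight ha hμ hpar lam
      have hs : Summable (weight a μ δ lam) := by simpa using hW.2 0
      rw [innerProd, eq_C_of_natDegree_le_zero hP]
      simp only [← C_1, evalAt_C, one_mul, coeff_C_zero]
      rw [hs.tsum_mul_right]
      simp
  | succ n ih =>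
    obtain ⟨Q, hQ1, hQ2, hQ3⟩ := ih (lam + 1)
    obtain ⟨R, hR1, hR2, hR3, hR4⟩ := exists_raising ha hμ hpar lam n Q hQ1
    refine ⟨R, hR1, ?_, fun P hP => ?_⟩
    · have hF : matF a μ (n + (lam + 1)) *
          (((N + lam + 1 : ℕ) : ℂ) • (1 : Mat N) - matJ N) =
          (((N + lam + 1 : ℕ) : ℂ) • (1 : Mat N) - (matJ N - (a : ℂ) • matA μ -
            ((lam + n + 1 : ℕ) : ℂ) • matM μ)) * matF a μ (n + (lam + 1)) := by
        rw [mul_sub, matF_mul_matJ hμ, sub_mul (_ • _), mul_smul_comm, smul_mul_assoc, mul_one,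
          one_mul, show n + (lam + 1) = lam + n + 1 by ring]
      have hF' : (matF a μ (n + (lam + 1)))⁻¹ * (((N + lam + 1 : ℕ) : ℂ) • (1 : Mat N) -
          (matJ N - (a : ℂ) • matA μ - ((lam + n + 1 : ℕ) : ℂ) • matM μ)) =
          (((N + lam + 1 : ℕ) : ℂ) • (1 : Mat N) - matJ N) * (matF a μ (n + (lam + 1)))⁻¹ := by
        refine (isUnit_matF (a := a) hμ (n + (lam + 1))).mul_right_cancel ?_
        rw [mul_assoc, ← hF, ← mul_assoc, Matrix.nonsing_inv_mul _ (hdet _), one_mul, mul_assoc,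
          Matrix.nonsing_inv_mul _ (hdet _), mul_one]
      rw [hR2, hQ2, mul_smul_comm, smul_mul_assoc, smul_smul, mul_assoc _ (matF a μ _)⁻¹, hF',
        ← mul_assoc, mul_assoc _ (matLam N _ _), ← matLam_succ, pow_succ', mul_comm (-1 / 2 : ℂ),
        show n + (lam + 1) = n + 1 + lam by ring]
    · obtain ⟨D, hD1, hD2, hD3⟩ := exists_forward_difference n P hP
      rw [innerProd_eq_neg_of_backward (isWeight_weight ha hμ hpar lam)
        (isWeight_weight ha hμ hpar (lam + 1)) hR3 hR4 hD3, hQ3 D hD1, hD2,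
        Matrix.conjTranspose_smul, mul_smul_comm, smul_smul, ← neg_smul,
        show lam + 1 + n = lam + (n + 1) by ring]
      congr 1
      rw [star_add, star_natCast, star_one, Nat.factorial_succ]
      push_cast
      ring

end Rodrigues

/-! ### The square norms -/

/-- Compare coefficients in (1−X)^{−(p+1)} (1−X)^{−(q+1)} = (1−X)^{−(p+q+2)}. -/
theorem sum_antidiagonal_choose_mul_choose (p q n : ℕ) :
    ∑ x ∈ Finset.HasAntidiagonal.antidiagonal n, (p + x.1).choose p * (q + x.2).choose q =
      (p + q + 1 + n).choose n := by
  have h := congrArg (fun u : (PowerSeries ℤ)ˣ => PowerSeries.coeff n u.val)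
    (PowerSeries.invOneSubPow_add ℤ (p + 1) (q + 1))
  simp only [Units.val_mul, PowerSeries.coeff_mul,
    PowerSeries.invOneSubPow_val_succ_eq_mk_add_choose, PowerSeries.coeff_mk,
    show p + 1 + (q + 1) = (p + q + 1) + 1 by ring] at h
  rw [Nat.choose_symm_add] at h
  exact_mod_cast h.symm

section SquareNorms

variable {N : ℕ} {a : ℝ} {μ : Fin N → ℝ} {δ : ℕ → Fin N → ℝ}

/-- The diagonal matrix `∑ₘ (aᵐ / m!) Aᵐ T^{(lam)} (A^*)ᵐ`. -/
def matY (N : ℕ) (a : ℝ) (lam : ℕ) : Mat N :=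
  Matrix.diagonal fun i : Fin N =>
    ((a : ℂ) / 2) ^ lam * (lam ! : ℂ) * ((N + lam).choose i : ℂ)

theorem term_eq_choose (ha : 0 < a) (hpar : ParameterChoice a μ δ) (lam : ℕ) {j k : Fin N}
    {m : ℕ} (h : (j : ℕ) = k + m) :
    a ^ m / (m ! : ℝ) * ((μ j / μ k) ^ 2 * δ lam k) = (a / 2) ^ lam * (lam ! : ℝ) *
      (((N - (j + 1) + m).choose (N - (j + 1)) * (lam + k).choose lam : ℕ) : ℝ) := by
  have hj := j.2
  have h1 := sq_ratio ha hpar h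
  rw [show N - ((k : ℕ) + 1) = N - (j + 1) + m by omega] at h1
  have h2 : (((N - (j + 1) + m).choose (N - (j + 1)) : ℕ) : ℝ) =
      ((N - (j + 1) + m) ! : ℝ) / ((N - (j + 1)) ! * m !) := by
    rw [Nat.cast_choose ℝ (Nat.le_add_right _ _), Nat.add_sub_cancel_left]
  have h3 : (((lam + k).choose lam : ℕ) : ℝ) = ((lam + k) ! : ℝ) / (lam ! * (k : ℕ) !) := by
    rw [Nat.cast_choose ℝ (Nat.le_add_right _ _), Nat.add_sub_cancel_left]
  have e : a ^ m / (m ! : ℝ) * ((μ j / μ k) ^ 2 * δ lam k) =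
      ((μ j / μ k) ^ 2 * a ^ m) * δ lam k / (m ! : ℝ) := by ring
  rw [e, h1, hpar.2]
  push_cast
  rw [h2, h3]
  have f1 : ((m ! : ℕ) : ℝ) ≠ 0 := by positivity
  have f2 : ((lam ! : ℕ) : ℝ) ≠ 0 := by positivity
  have f3 : (((k : ℕ) ! : ℕ) : ℝ) ≠ 0 := by positivity
  have f4 : (((N - ((j : ℕ) + 1)) ! : ℕ) : ℝ) ≠ 0 := by positivity
  field_simp

/-- Powers of A are weighted shifts, so every term is diagonal and the series is finite. By
`term_eq_choose` each diagonal entry is a convolution of binomials. -/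
theorem hasSum_matY (ha : 0 < a) (hμ : ∀ j, 0 < μ j) (hpar : ParameterChoice a μ δ)
    (lam : ℕ) :
    HasSum (fun n : ℕ => ((a : ℂ) ^ n / (n ! : ℂ)) •
      (matA μ ^ n * matT (δ lam) * (matA μ)ᴴ ^ n)) (matY N a lam) := by
  have hY : matY N a lam = ∑ m ∈ Finset.range N, ((a : ℂ) ^ m / (m ! : ℂ)) •
      (matA μ ^ m * matT (δ lam) * (matA μ)ᴴ ^ m) := by
    have hent : ∀ (m : ℕ) (j k : Fin N),
        (matA μ ^ m * matT (δ lam) * (matA μ)ᴴ ^ m) j k =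
          ∑ l : Fin N, if (j : ℕ) = l + m ∧ (k : ℕ) = l + m then
            (((μ j / μ l) * (μ k / μ l) * δ lam l : ℝ) : ℂ) else 0 := by
      intro m j k
      rw [← Matrix.conjTranspose_pow, Matrix.mul_apply]
      refine Finset.sum_congr rfl fun l _ => ?_
      rw [matT, Matrix.mul_diagonal, Matrix.conjTranspose_apply, matA_pow_apply hμ,
        matA_pow_apply hμ]
      by_cases h1 : (j : ℕ) = l + m
      · by_cases h2 : (k : ℕ) = l + m
        · rw [if_pos h1, if_pos h2, if_pos ⟨h1, h2⟩, Complex.star_def, Complex.conj_ofReal]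
          push_cast; ring
        · rw [if_neg h2, if_neg (fun h => h2 (And.right h)), star_zero, mul_zero]
      · rw [if_neg h1, if_neg (fun h => h1 (And.left h)), zero_mul, zero_mul]
    ext j k
    rw [Matrix.sum_apply]
    simp only [Matrix.smul_apply, hent, smul_eq_mul]
    by_cases hjk : j = k
    · subst hjk
      have hj := j.2
      have hsub : Finset.range (j + 1) ⊆ Finset.range N :=
        Finset.range_subset_range.2 hj
      rw [matY, Matrix.diagonal_apply_eq, ← Finset.sum_subset hsub]
      · have hterm : ∀ m ∈ Finset.range ((j : ℕ) + 1), (a : ℂ) ^ m / (m ! : ℂ) *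
            (∑ l : Fin N, if (j : ℕ) = l + m ∧ (j : ℕ) = l + m then
              (((μ j / μ l) * (μ j / μ l) * δ lam l : ℝ) : ℂ) else 0) =
            ((a : ℂ) / 2) ^ lam * (lam ! : ℂ) * (((N - (j + 1) + m).choose (N - (j + 1)) *
              (lam + (j - m)).choose lam : ℕ) : ℂ) := by
          intro m hm
          have hm' : m ≤ j := Nat.lt_succ_iff.1 (Finset.mem_range.1 hm)
          have hl : (j : ℕ) - m < N := by omega
          have hjm : (j : ℕ) = (j : ℕ) - m + m := by omega
          rw [Finset.sum_eq_single ⟨(j : ℕ) - m, hl⟩]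
          · rw [if_pos ⟨hjm, hjm⟩]
            have := term_eq_choose ha hpar lam (j := j) (k := ⟨(j : ℕ) - m, hl⟩) hjm
            rw [← sq]
            exact_mod_cast congrArg (fun r : ℝ => (r : ℂ)) this
          · intro l _ hl'
            rw [if_neg]
            rintro ⟨h, -⟩
            exact hl' (Fin.ext (by simp only; omega))
          · simp
        have hV := sum_antidiagonal_choose_mul_choose (N - (j + 1)) lam j
        rw [Finset.Nat.sum_antidiagonal_eq_sum_range_succ
          (fun x y => (N - (j + 1) + x).choose (N - (j + 1)) * (lam + y).choose lam),
          show N - ((j : ℕ) + 1) + lam + 1 + j = N + lam by omega] at hV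
        rw [Finset.sum_congr rfl hterm, ← Finset.mul_sum, ← Nat.cast_sum, ← hV]
      · intro m _ hm
        rw [Finset.sum_eq_zero, mul_zero]
        intro l _
        rw [if_neg]
        rintro ⟨h, -⟩
        exact hm (Finset.mem_range.2 (by omega))
    · rw [matY, Matrix.diagonal_apply_ne _ hjk, Finset.sum_eq_zero]
      intro m _
      rw [Finset.sum_eq_zero, mul_zero]
      intro l _
      rw [if_neg]
      rintro ⟨h1, h2⟩
      exact hjk (Fin.ext (h1.trans h2.symm))
  rw [hY]
  refine hasSum_sum_of_ne_finset_zero fun m hm => ?_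
  rw [matA_pow_eq_zero hμ (by simpa using hm), zero_mul, zero_mul, smul_zero]

theorem isUnit_smul_of_ne_zero {c : ℂ} (hc : c ≠ 0) {M : Mat N} (hM : IsUnit M) :
    IsUnit (c • M) :=
  hM.smul (Units.mk0 c hc)

theorem isUnit_matY (ha : 0 < a) (lam : ℕ) : IsUnit (matY N a lam) := by
  rw [matY, Matrix.isUnit_iff_isUnit_det, Matrix.det_diagonal]
  refine (Finset.prod_ne_zero_iff.2 fun i _ => ?_).isUnit
  have h1 : ((N + lam).choose i : ℂ) ≠ 0 := by
    exact_mod_cast (Nat.choose_pos (by have := i.2; omega)).ne'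
  have h2 : ((lam ! : ℕ) : ℂ) ≠ 0 := by exact_mod_cast (Nat.factorial_pos lam).ne'
  have h3 : (a : ℂ) ≠ 0 := by exact_mod_cast ha.ne'
  positivity

theorem tsum_weight_eq (ha : 0 < a) (hμ : ∀ j, 0 < μ j) (hpar : ParameterChoice a μ δ)
    (lam : ℕ) : ∑' x, weight a μ δ lam x =
      (Real.exp a : ℂ) • (matF a μ lam * matY N a lam * (matF a μ lam)ᴴ) :=
  tsum_weight lam _ (hasSum_matY ha hμ hpar lam)

theorem isUnit_tsum_weight (ha : 0 < a) (hμ : ∀ j, 0 < μ j) (hpar : ParameterChoice a μ δ)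
    (lam : ℕ) : IsUnit (∑' x, weight a μ δ lam x) := by
  rw [tsum_weight_eq ha hμ hpar]
  refine isUnit_smul_of_ne_zero ?_ ?_
  · exact_mod_cast (Real.exp_pos a).ne'
  · exact ((isUnit_matF hμ lam).mul (isUnit_matY ha lam)).mul
      ((Matrix.isUnit_conjTranspose _).2 (isUnit_matF hμ lam))

/-- Existence and uniqueness of the monic orthogonal polynomials, with their square norms. -/
theorem mvop_weight (hN : 0 < N) (ha : 0 < a) (hμ : ∀ j, 0 < μ j)
    (hpar : ParameterChoice a μ δ) (lam : ℕ) :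
    (∃! P : ℕ → (Mat N)[X], IsMonicMVOP (weight a μ δ lam) P) ∧
      ∀ P : ℕ → (Mat N)[X], IsMonicMVOP (weight a μ δ lam) P → ∀ n,
        sqNorm (weight a μ δ lam) P n = ((n ! : ℂ) * 2 ^ n) •
          (matF a μ (n + lam) * (matLam N lam n)⁻¹ * (matF a μ (n + lam))⁻¹ *
            ∑' x, weight a μ δ (n + lam) x) := by
  have : Nonempty (Fin N) := ⟨⟨0, hN⟩⟩
  choose R hR1 hR2 hR3 using fun n => exists_rodrigues ha hμ hpar n lam
  have hW := isWeight_weight ha hμ hpar lam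
  have hFdet : ∀ k, IsUnit (matF a μ k).det := fun k =>
    (Matrix.isUnit_iff_isUnit_det _).1 (isUnit_matF hμ k)
  have hLdet : ∀ k, IsUnit (matLam N lam k).det := fun k =>
    (Matrix.isUnit_iff_isUnit_det _).1 (isUnit_matLam N lam k)
  set K : ℕ → Mat N := fun n =>
    ((-1) ^ n * (n ! : ℂ)) • ∑' x, weight a μ δ (lam + n) x with hKdef
  have hdual : ∀ n P, P.natDegree ≤ n →
      innerProd (weight a μ δ lam) (R n) P = K n * (P.coeff n)ᴴ := fun n P hP => by
    rw [hR3 n P hP, hKdef, smul_mul_assoc]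
  have hK : ∀ n, IsUnit (K n) := fun n => by
    refine isUnit_smul_of_ne_zero ?_ (isUnit_tsum_weight ha hμ hpar _)
    have : ((n ! : ℕ) : ℂ) ≠ 0 := by exact_mod_cast (Nat.factorial_pos n).ne'
    exact mul_ne_zero (pow_ne_zero _ (by norm_num)) this
  have hG : ∀ n, IsUnit ((R n).coeff n) := fun n => by
    rw [hR2]
    refine isUnit_smul_of_ne_zero (pow_ne_zero _ (by norm_num)) ?_
    exact ((isUnit_matF hμ _).mul (isUnit_matLam N lam n)).mul
      (Matrix.isUnit_nonsing_inv_iff.2 (isUnit_matF hμ _))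
  have hGinv : ∀ n, ((R n).coeff n)⁻¹ = ((-2 : ℂ) ^ n) •
      (matF a μ (n + lam) * (matLam N lam n)⁻¹ * (matF a μ (n + lam))⁻¹) := fun n => by
    refine Matrix.inv_eq_right_inv ?_
    rw [hR2, smul_mul_smul_comm, ← mul_pow, show (-1 / 2 : ℂ) * -2 = 1 by norm_num, one_pow,
      one_smul]
    simp only [mul_assoc]
    rw [← mul_assoc (matF a μ (n + lam))⁻¹, Matrix.nonsing_inv_mul _ (hFdet _), one_mul,
      ← mul_assoc (matLam N lam n), Matrix.mul_nonsing_inv _ (hLdet _), one_mul,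
      Matrix.mul_nonsing_inv _ (hFdet _)]
  have hP₀ := isMonicMVOP_of_dual hW hR1 hG hdual
  have huniq : ∀ P : ℕ → (Mat N)[X], IsMonicMVOP (weight a μ δ lam) P →
      P = fun n => C ((R n).coeff n)⁻¹ * R n := fun P hP =>
    hP.eq_of_dual hW hR1 hK hdual hP₀
  refine ⟨⟨_, hP₀, huniq⟩, fun P hP n => ?_⟩
  have hlead : (P n).coeff n = 1 := by
    have := (hP.1 n).1.coeff_natDegree
    rwa [(hP.1 n).2] at this
  have hPn : P n = C ((R n).coeff n)⁻¹ * R n := congrFun (huniq P hP) n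
  -- Only the left P_n is replaced by its multiple of R_n; duality then reads off the leading
  -- coefficient 1 of the right one.
  have : sqNorm (weight a μ δ lam) P n = ((R n).coeff n)⁻¹ * K n := by
    rw [sqNorm]
    conv_lhs => rw [hPn, innerProd_C_mul_left hW, ← hPn]
    rw [hdual n _ (hP.1 n).2.le, hlead, Matrix.conjTranspose_one, mul_one]
  rw [this, hGinv, hKdef, smul_mul_smul_comm, add_comm lam n]
  congr 1
  rw [show (-2 : ℂ) = (-1) * 2 by norm_num, mul_pow]
  have : ((-1 : ℂ) ^ n) * (-1) ^ n = 1 := by rw [← mul_pow]; norm_num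
  linear_combination ((n ! : ℂ) * 2 ^ n) * this

theorem midFactor_eq (hμ : ∀ j, 0 < μ j) (k : ℕ) (H : Mat N) :
    midFactor a μ k H = (matF a μ k)⁻¹ * H * ((matF a μ k)⁻¹)ᴴ := by
  rw [midFactor, ← matF_inv hμ, one_add_conjTranspose_pow, ← Matrix.conjTranspose_nonsing_inv,
    Matrix.conjTranspose_mul, ← mul_assoc]

/-- F cancels between ℋ_n = n! 2ⁿ F Λ⁻¹ F⁻¹ · e^a F Y F* and the outer factors; the diagonal Λ⁻¹ and
Y commute. -/
theorem matD_eq (hN : 0 < N) (ha : 0 < a) (hμ : ∀ j, 0 < μ j)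
    (hpar : ParameterChoice a μ δ) {P : ℕ → ℕ → (Mat N)[X]}
    (hP : ∀ lam, IsMonicMVOP (weight a μ δ lam) (P lam)) (lam n : ℕ) :
    matD a μ δ P lam n = ((n ! : ℂ) * 2 ^ n * (Real.exp a : ℂ)) •
      (matY N a (n + lam) * (matLam N lam n)⁻¹) := by
  have hFdet : IsUnit (matF a μ (n + lam)).det :=
    (Matrix.isUnit_iff_isUnit_det _).1 (isUnit_matF hμ _)
  have hcomm : (matLam N lam n)⁻¹ * matY N a (n + lam) =
      matY N a (n + lam) * (matLam N lam n)⁻¹ := by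
    rw [matLam_eq_diagonal, Matrix.inv_diagonal, matY, Matrix.diagonal_mul_diagonal,
      Matrix.diagonal_mul_diagonal]
    simp only [mul_comm]
  have hFs : (matF a μ (n + lam))ᴴ * ((matF a μ (n + lam))⁻¹)ᴴ = 1 := by
    rw [← Matrix.conjTranspose_mul, Matrix.nonsing_inv_mul _ hFdet, Matrix.conjTranspose_one]
  rw [matD, midFactor_eq hμ, (mvop_weight hN ha hμ hpar lam).2 _ (hP lam),
    tsum_weight_eq ha hμ hpar]
  simp only [mul_smul_comm, smul_mul_assoc, smul_smul, mul_assoc, hFs]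
  rw [← mul_assoc (matF a μ (n + lam))⁻¹ (matF a μ (n + lam)),
    ← mul_assoc (matF a μ (n + lam))⁻¹ (matF a μ (n + lam)),
    Matrix.nonsing_inv_mul _ hFdet, one_mul, one_mul, mul_one, hcomm]

/-- Both Pochhammer symbols are factorial quotients, the first with sign (−1)^j. That sign cancels
the prefactor, which makes positivity visible. -/
theorem entryD_eq (lam n : ℕ) (i : Fin N) :
    entryD N a lam n (i + 1) = (n ! : ℂ) * 2 ^ n * (Real.exp a : ℂ) *
      (((a : ℂ) / 2) ^ (n + lam) * ((n + lam) ! : ℂ) * ((N + (n + lam)).choose i : ℂ) *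
        (((N + lam + n - (i + 1)) ! : ℂ) / ((N + lam - (i + 1)) ! : ℂ))⁻¹) := by
  have hf : ∀ k : ℕ, ((k ! : ℕ) : ℂ) ≠ 0 := fun k => by
    exact_mod_cast (Nat.factorial_pos k).ne'
  have hi := i.2
  have h1 : poch (-(N : ℂ) - lam - n) (i + 1) =
      (-1) ^ ((i : ℕ) + 1) * (((N + (n + lam)) ! : ℂ) / ((N + lam + n - (i + 1)) ! : ℂ)) := by
    rw [poch, show -(N : ℂ) - lam - n = -((N + lam + n : ℕ) : ℂ) by push_cast; ring,
      ascPochhammer_eval_neg_eq_descPochhammer, descPochhammer_eval_eq_descFactorial]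
    congr 1
    rw [eq_div_iff (hf _), ← Nat.cast_mul, mul_comm,
      Nat.factorial_mul_descFactorial (by omega), show N + (n + lam) = N + lam + n by ring]
  have h2 : poch ((lam : ℂ) + n + 1) (N - (i + 1) + 1) =
      ((N + (n + lam) - i) ! : ℂ) / ((n + lam) ! : ℂ) := by
    rw [poch, show (lam : ℂ) + n + 1 = ((n + lam + 1 : ℕ) : ℂ) by push_cast; ring,
      ← ascPochhammer_eval_cast, ascPochhammer_nat_eq_ascFactorial, eq_div_iff (hf _),
      ← Nat.cast_mul, mul_comm, Nat.factorial_mul_ascFactorial,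
      show n + lam + (N - ((i : ℕ) + 1) + 1) = N + (n + lam) - i by omega]
  have h3 : ((N + (n + lam)).choose i : ℂ) =
      ((N + (n + lam)) ! : ℂ) / (((i : ℕ) ! : ℂ) * ((N + (n + lam) - i) ! : ℂ)) :=
    Nat.cast_choose ℂ (by omega)
  rw [entryD, h1, h2, h3, Nat.add_sub_cancel, add_comm lam N, pow_add ((a : ℂ) / 2) n lam,
    div_pow (a : ℂ) 2 n]
  have h4 : ((-1 : ℂ) ^ ((i : ℕ) + 1)) * (-1) ^ ((i : ℕ) + 1) = 1 := by
    rw [← mul_pow]; norm_num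
  have f1 := hf (N + lam + n - (i + 1))
  have f2 := hf (N + lam - (i + 1))
  have f3 := hf (N + (n + lam) - i)
  have f4 := hf i
  have f5 := hf (n + lam)
  generalize (-1 : ℂ) ^ ((i : ℕ) + 1) = s at h4 ⊢
  generalize ((a : ℂ) / 2) ^ lam = t
  field_simp
  linear_combination ((a : ℂ) ^ n * t) * h4

theorem entryD_pos (ha : 0 < a) (lam n : ℕ) (i : Fin N) : 0 < entryD N a lam n (i + 1) := by
  have hc : 0 < (N + (n + lam)).choose i := Nat.choose_pos (by have := i.2; omega)
  have : 0 < (n ! : ℝ) * 2 ^ n * Real.exp a *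
      ((a / 2) ^ (n + lam) * ((n + lam) ! : ℝ) * ((N + (n + lam)).choose i : ℝ) *
        (((N + lam + n - (i + 1)) ! : ℝ) / ((N + lam - (i + 1)) ! : ℝ))⁻¹) := by
    positivity
  rw [entryD_eq]
  have h := Complex.zero_lt_real.2 this
  push_cast at h ⊢
  exact h

theorem matD_eq_diagonal (hN : 0 < N) (ha : 0 < a) (hμ : ∀ j, 0 < μ j)
    (hpar : ParameterChoice a μ δ) {P : ℕ → ℕ → (Mat N)[X]}
    (hP : ∀ lam, IsMonicMVOP (weight a μ δ lam) (P lam)) (lam n : ℕ) :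
    matD a μ δ P lam n =
      Matrix.diagonal fun i : Fin N => entryD N a lam n ((i : ℕ) + 1) := by
  have hf : ∀ k : ℕ, ((k ! : ℕ) : ℂ) ≠ 0 := fun k => by
    exact_mod_cast (Nat.factorial_pos k).ne'
  have hinv : (matLam N lam n)⁻¹ = Matrix.diagonal fun i : Fin N =>
      (((N + lam + n - (i + 1)) ! : ℂ) / ((N + lam - (i + 1)) ! : ℂ))⁻¹ := by
    refine Matrix.inv_eq_right_inv ?_
    rw [matLam_eq_diagonal, Matrix.diagonal_mul_diagonal, ← Matrix.diagonal_one]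
    congr 1
    funext i
    exact mul_inv_cancel₀ (div_ne_zero (hf _) (hf _))
  rw [matD_eq hN ha hμ hpar hP, hinv, matY, Matrix.diagonal_mul_diagonal, ← Matrix.diagonal_smul]
  congr 1
  funext i
  rw [entryD_eq]
  rfl

theorem eq_mul_midFactor_mul (hμ : ∀ j, 0 < μ j) (k : ℕ) (H : Mat N) :
    H = (matL a μ 0)⁻¹ * (1 + matA μ) ^ k * midFactor a μ k H *
      (1 + (matA μ)ᴴ) ^ k * ((matL a μ 0)ᴴ)⁻¹ := by
  have hFdet : IsUnit (matF a μ k).det :=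
    (Matrix.isUnit_iff_isUnit_det _).1 (isUnit_matF hμ _)
  have hF : (matL a μ 0)⁻¹ * (1 + matA μ) ^ k = matF a μ k := by
    rw [matL_zero hμ, ← Matrix.exp_neg, neg_neg, matF]
  have hF' : (1 + (matA μ)ᴴ) ^ k * ((matL a μ 0)ᴴ)⁻¹ = (matF a μ k)ᴴ := by
    rw [← hF, Matrix.conjTranspose_mul, one_add_conjTranspose_pow,
      Matrix.conjTranspose_nonsing_inv]
  rw [mul_assoc _ ((1 + (matA μ)ᴴ) ^ k), hF', hF, midFactor_eq hμ]
  simp only [mul_assoc]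
  rw [← Matrix.conjTranspose_mul, Matrix.mul_nonsing_inv _ hFdet, Matrix.conjTranspose_one,
    mul_one, ← mul_assoc, Matrix.mul_nonsing_inv _ hFdet, one_mul]

end SquareNorms

end MVCharlier

end

/-! ### The main theorem -/

open MVCharlier in
theorem theorem6p4 (N : ℕ) (hN : 0 < N) (a : ℝ) (ha : 0 < a)
    (μ : Fin N → ℝ) (hμ : ∀ j, 0 < μ j) (δ : ℕ → Fin N → ℝ)
    (hpar : ParameterChoice a μ δ) :
    (∀ lam : ℕ, IsWeight (weight a μ δ lam) ∧
      ∃! P : ℕ → Polynomial (Mat N), IsMonicMVOP (weight a μ δ lam) P) ∧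
    ∀ P : ℕ → ℕ → Polynomial (Mat N),
      (∀ lam : ℕ, IsMonicMVOP (weight a μ δ lam) (P lam)) →
      ∀ lam n : ℕ,
        (matD a μ δ P lam n).PosDef ∧
        sqNorm (weight a μ δ lam) (P lam) n =
          (matL a μ 0)⁻¹ * (1 + matA μ) ^ (n + lam) * matD a μ δ P lam n *
            (1 + (matA μ)ᴴ) ^ (n + lam) * ((matL a μ 0)ᴴ)⁻¹ ∧
        matD a μ δ P lam n =
          Matrix.diagonal (fun i : Fin N => entryD N a lam n ((i : ℕ) + 1)) ∧
        matD a μ δ P lam n =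
          ((n.factorial : ℂ) * 2 ^ n) • (matD a μ δ P (lam + n) 0 * (matLam N lam n)⁻¹) := by
  refine ⟨fun lam => ⟨isWeight_weight ha hμ hpar lam, (mvop_weight hN ha hμ hpar lam).1⟩,
    fun P hP lam n => ⟨?_, ?_, matD_eq_diagonal hN ha hμ hpar hP lam n, ?_⟩⟩
  · rw [matD_eq_diagonal hN ha hμ hpar hP]
    exact Matrix.PosDef.diagonal fun i => entryD_pos ha lam n i
  · exact eq_mul_midFactor_mul hμ (n + lam) _
  -- Λ₀ is the empty product, so 𝒟_0^{(λ+n)} = e^a Y^{(λ+n)}.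
  · rw [matD_eq hN ha hμ hpar hP, matD_eq hN ha hμ hpar hP (lam + n) 0, smul_mul_assoc, smul_smul]
    simp [matLam, add_comm]
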